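/- Setting. Let $\Omega\subset\mathbb R^d$ be open, bounded and convex with diameter $D$; let $M,N\ge 1$, $a_{\min},\Delta_{\min},\varepsilon,\beta,\lambda>0$. Let $\mathcal M$ be the set of $(a,x)\in\mathbb R^M\times\Omega^M$ with $a_m>a_{\min}$, $\sum_m a_m=1$ and $\|x_m-x_n\|>\Delta_{\min}$ for $m\ne n$, let $\Xi(a,x)=\sum_m a_m\delta_{x_m}$ and $\mathcal P=\Xi(\mathcal M)$. With $c(x,y)=\frac12\|x-y\|^2$ put $\mathrm{OT}_\varepsilon(\mu,\nu)=\inf_{\pi\in\Pi(\mu,\nu)}\int c\,d\pi+\varepsilon\,\mathrm{KL}(\pi\,|\,\mu\otimes\nu)$ and $S_\varepsilon(\mu,\nu)=\mathrm{OT}_\varepsilon(\mu,\nu)-\frac12\mathrm{OT}_\varepsilon(\mu,\mu)-\frac12\mathrm{OT}_\varepsilon(\nu,\nu)$. The stored patterns are $X_j=\Xi(b_j,y_j)$ with $(b_j,y_j)\in\mathcal M$, $j=1,\dots,N$, and the energy is $E(\xi)=-\frac1\beta\log\sum_{j=1}^N e^{-\beta S_\varepsilon(\xi,X_j)}$. Let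 $B_i(r)=\{\xi\in\mathcal P: S_\varepsilon(\xi,X_i)\le r\}$. The tangent vectors at $(a,x)\in\mathcal M$ are the $(\delta a,\delta x)\in\mathbb R^M\times(\mathbb R^d)^M$ with $\sum_m\delta a_m=0$, with the spherical Hellinger--Kantorovich (SHK) metric $\langle(\delta a,\delta x),(\delta a',\delta x')\rangle_{(a,x)}=\sum_m\big(\frac{\lambda^2}{a_m}\delta a_m\delta a_m'+a_m\,\delta x_m\cdot\delta x_m'\big)$; $\operatorname{grad}E(a,x)$ is the tangent vector that represents the differential of $E\circ\Xi$ on $\mathcal M$ through this metric. The retraction is $\operatorname{Ret}_{(a,x)}(\delta a,\delta x)=\Big(\big(a_me^{\delta a_m/a_m}/\sum_k a_ke^{\delta a_k/a_k}\big)_m,\ x+\delta x\Big)$, and $\Phi_\eta(\Xi(a,x))=\Xi\big(\operatorname{Ret}_{(a,x)}(-\eta\operatorname{grad}E(a,x))\big)$. Theorem. Fix $i$ and suppose that, for some $r>0$ and $\Delta>0$, margin separation holds: $S_\varepsilon(\xi,X_j)-S_\varepsilon(\xi,X_i)\ge\Delta$ for all $\xi\in B_i(r)$ and all $j\ne i$.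 Then: (1) Every minimizer $X_i^*(r)$ of $E$ over $B_i(r)$ (in particular the unique one, if it exists uniquely) satisfies $$S_\varepsilon(X_i^*(r),X_i)\le\frac1\beta\log\big(1+(N-1)e^{-\beta\Delta}\big)\le\frac{N-1}{\beta}e^{-\beta\Delta}.$$ (2) The gradient of $E$ at $(b_i,y_i)$ exists and is unique. Let $d_i^\partial=\min_m\operatorname{dist}(y_{i,m},\partial\Omega)$ and $s_i=\min_{m\ne n}\|y_{i,m}-y_{i,n}\|$ (with $s_i=+\infty$ if $M=1$), let $0<\delta_i<\min\{d_i^\partial,\frac{s_i-\Delta_{\min}}2\}$ and $0<\tau_i<\min_m b_{i,m}-a_{\min}$, and put $$\eta_{\mathrm{ret},i}=\min\Big\{\frac{\lambda^2}{2D^2}\log\frac{\min_m b_{i,m}-\tau_i}{a_{\min}},\ \frac1{2D}\min\{d_i^\partial-\delta_i,\ s_i-2\delta_i-\Delta_{\min}\}\Big\}.$$ Then for every $0<\eta\le\eta_{\mathrm{ret},i}$ the step $\operatorname{Ret}_{(b_i,y_i)}(-\eta\operatorname{grad}E(b_i,y_i))$ lies in $\mathcal M$, and with $G=D\sqrt{1+D^2/\lambda^2}$,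 $$S_\varepsilon(X_i,\Phi_\eta(X_i))\le\frac{\min\big\{e^{\eta D^2/\lambda^2},a_{\min}^{-1/2}\big\}\,\eta\,G^2\,(N-1)e^{-\beta\Delta}}{1+(N-1)e^{-\beta\Delta}}.$$ -/

import Mathlib

open MeasureTheory

namespace SinkhornSHK

/-! ### Entropic optimal transport and the Sinkhorn divergence -/

section OptimalTransport

/-- Couplings `Π(μ, ν)`: measures on the product with marginals `μ` and `ν`. -/
def couplings {E : Type*} [MeasurableSpace E] (μ ν : Measure E) : Set (Measure (E × E)) :=
  {π | π.map Prod.fst = μ ∧ π.map Prod.snd = ν}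

/-- The entropic transport objective `∫ c dπ + ε KL(π | μ ⊗ ν)` for the quadratic cost
`c(x, y) = ‖x - y‖² / 2`, as an extended nonnegative number. -/
noncomputable def entropicCost {d : ℕ} (ε : ℝ) (μ ν : Measure (EuclideanSpace ℝ (Fin d)))
    (π : Measure (EuclideanSpace ℝ (Fin d) × EuclideanSpace ℝ (Fin d))) : ENNReal :=
  (∫⁻ z, ENNReal.ofReal (‖z.1 - z.2‖ ^ 2 / 2) ∂π) +
    ENNReal.ofReal ε * InformationTheory.klDiv π (μ.prod ν)

/-- The entropic optimal transport cost `OT_ε(μ, ν)`. -/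
noncomputable def entropicOT {d : ℕ} (ε : ℝ) (μ ν : Measure (EuclideanSpace ℝ (Fin d))) : ℝ :=
  (⨅ π ∈ couplings μ ν, entropicCost ε μ ν π).toReal

/-- The debiased Sinkhorn divergence `S_ε(μ, ν)`. -/
noncomputable def sinkhorn {d : ℕ} (ε : ℝ) (μ ν : Measure (EuclideanSpace ℝ (Fin d))) : ℝ :=
  entropicOT ε μ ν - entropicOT ε μ μ / 2 - entropicOT ε ν ν / 2

/-- The log-sum-exp energy `E(ξ) = -(1/β) log ∑ i, exp (-β S_ε(ξ, X_i))`. -/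
noncomputable def energy {d N : ℕ} (ε β : ℝ) (X : Fin N → Measure (EuclideanSpace ℝ (Fin d)))
    (ξ : Measure (EuclideanSpace ℝ (Fin d))) : ℝ :=
  -(1 / β) * Real.log (∑ i, Real.exp (-β * sinkhorn ε ξ (X i)))

end OptimalTransport

/-! ### Discrete measures with `M` atoms and their parameters -/

section Particles

/-- Pairs `(a, x)` of weights and locations; also the ambient space of tangent vectors. -/
abbrev Params (M d : ℕ) : Type :=
  (Fin M → ℝ) × (Fin M → EuclideanSpace ℝ (Fin d))

/-- The discrete measure `Ξ(a, x) = ∑ m, a_m δ_{x_m}`. -/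
noncomputable def toMeasure {M d : ℕ} (p : Params M d) : Measure (EuclideanSpace ℝ (Fin d)) :=
  ∑ m, ENNReal.ofReal (p.1 m) • Measure.dirac (p.2 m)

/-- The parameter space: weights larger than `amin` that sum to one, and locations in `Ω` that
are pairwise at distance larger than `Dmin`. -/
def paramSpace {d : ℕ} (M : ℕ) (Ω : Set (EuclideanSpace ℝ (Fin d))) (amin Dmin : ℝ) :
    Set (Params M d) :=
  {p | (∀ m, amin < p.1 m) ∧ ∑ m, p.1 m = 1 ∧ (∀ m, p.2 m ∈ Ω) ∧
    ∀ m n, m ≠ n → Dmin < ‖p.2 m - p.2 n‖}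

/-- The space of measures `∑ m, a_m δ_{x_m}` with `(a, x)` in the parameter space. -/
def patternSpace {d : ℕ} (M : ℕ) (Ω : Set (EuclideanSpace ℝ (Fin d))) (amin Dmin : ℝ) :
    Set (Measure (EuclideanSpace ℝ (Fin d))) :=
  {ξ | ∃ p ∈ paramSpace M Ω amin Dmin, ξ = toMeasure p}

/-- The Sinkhorn basin `B(r)` of radius `r` around `X`. -/
def basin {d : ℕ} (M : ℕ) (Ω : Set (EuclideanSpace ℝ (Fin d))) (amin Dmin ε : ℝ)
    (X : Measure (EuclideanSpace ℝ (Fin d))) (r : ℝ) :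
    Set (Measure (EuclideanSpace ℝ (Fin d))) :=
  {ξ | ξ ∈ patternSpace M Ω amin Dmin ∧ sinkhorn ε ξ X ≤ r}

/-- The smallest weight. -/
noncomputable def minWeight {M : ℕ} (a : Fin M → ℝ) : ℝ := ⨅ m, a m

/-- The distance `min_m dist(x_m, ∂Ω)` of the atoms from the boundary of `Ω`. -/
noncomputable def boundaryDist {M d : ℕ} (Ω : Set (EuclideanSpace ℝ (Fin d)))
    (x : Fin M → EuclideanSpace ℝ (Fin d)) : ℝ :=
  ⨅ m, Metric.infDist (x m) (frontier Ω)

/-- The minimal pairwise distance of the atoms; it is `⊤` for a single atom. -/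
noncomputable def atomSep {M d : ℕ} (x : Fin M → EuclideanSpace ℝ (Fin d)) : EReal :=
  ⨅ (m : Fin M) (n : Fin M) (_ : m ≠ n), ((‖x m - x n‖ : ℝ) : EReal)

end Particles

/-! ### The spherical Hellinger-Kantorovich geometry on the parameter space -/

section Geometry

/-- The tangent space of the parameter space: the weight increments sum to zero. -/
def tangent (M d : ℕ) : Set (Params M d) := {v | ∑ m, v.1 m = 0}

/-- The SHK metric `∑ m, ((λ² / a_m) δa_m δa'_m + a_m ⟨δx_m, δx'_m⟩)` at `p = (a, x)`. -/
noncomputable def shkInner {M d : ℕ} (lam : ℝ) (p v w : Params M d) : ℝ :=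
  ∑ m, (lam ^ 2 / p.1 m * v.1 m * w.1 m + p.1 m * inner ℝ (v.2 m) (w.2 m))

/-- `g` is the Riemannian (SHK) gradient at `p` of the functional `F`: it is a tangent vector, and
`p ↦ F (Ξ p)` is differentiable at `p` along the parameter space, with a differential that is
represented on tangent vectors by `g` through the SHK metric. -/
def IsSHKGradient {M d : ℕ} (Ω : Set (EuclideanSpace ℝ (Fin d))) (amin Dmin lam : ℝ)
    (F : Measure (EuclideanSpace ℝ (Fin d)) → ℝ) (p g : Params M d) : Prop :=
  g ∈ tangent M d ∧ ∃ L : Params M d →L[ℝ] ℝ,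
    HasFDerivWithinAt (fun q : Params M d => F (toMeasure q)) L (paramSpace M Ω amin Dmin) p ∧
    ∀ v ∈ tangent M d, shkInner lam p g v = L v

/-- The SHK gradient (meaningful where it exists, and then unique). -/
noncomputable def shkGradient {M d : ℕ} (Ω : Set (EuclideanSpace ℝ (Fin d)))
    (amin Dmin lam : ℝ) (F : Measure (EuclideanSpace ℝ (Fin d)) → ℝ) (p : Params M d) :
    Params M d :=
  Classical.epsilon fun g => IsSHKGradient Ω amin Dmin lam F p g

/-- The retraction: multiplicative normalized update of the weights `a_m exp (δa_m / a_m)`,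
translation of the locations. -/
noncomputable def retraction {M d : ℕ} (p v : Params M d) : Params M d :=
  (fun m => p.1 m * Real.exp (v.1 m / p.1 m) / ∑ j, p.1 j * Real.exp (v.1 j / p.1 j),
    fun m => p.2 m + v.2 m)

/-- One step `Ret_p (-η grad F)` of SHK gradient descent, in particle coordinates. -/
noncomputable def shkStep {M d : ℕ} (Ω : Set (EuclideanSpace ℝ (Fin d))) (amin Dmin lam : ℝ)
    (F : Measure (EuclideanSpace ℝ (Fin d)) → ℝ) (η : ℝ) (p : Params M d) : Params M d :=
  retraction p (-η • shkGradient Ω amin Dmin lam F p)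

end Geometry

/-! ### Assumptions and constants -/

section Constants

/-- Margin separation of the basin of the pattern `X i`. -/
def MarginSeparation {d N : ℕ} (M : ℕ) (Ω : Set (EuclideanSpace ℝ (Fin d)))
    (amin Dmin ε : ℝ) (X : Fin N → Measure (EuclideanSpace ℝ (Fin d))) (i : Fin N)
    (r Δ : ℝ) : Prop :=
  ∀ ξ ∈ basin M Ω amin Dmin ε (X i) r, ∀ j, j ≠ i →
    Δ ≤ sinkhorn ε ξ (X j) - sinkhorn ε ξ (X i)

/-- `ξ` is a minimizer of the energy in the basin of radius `r` around `X i`. -/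
def IsBasinMinimizer {d N : ℕ} (M : ℕ) (Ω : Set (EuclideanSpace ℝ (Fin d)))
    (amin Dmin ε β : ℝ) (X : Fin N → Measure (EuclideanSpace ℝ (Fin d))) (i : Fin N) (r : ℝ)
    (ξ : Measure (EuclideanSpace ℝ (Fin d))) : Prop :=
  ξ ∈ basin M Ω amin Dmin ε (X i) r ∧
    ∀ ζ ∈ basin M Ω amin Dmin ε (X i) r, energy ε β X ξ ≤ energy ε β X ζ

/-- The gradient bound `G = D √(1 + D² / λ²)`. -/
noncomputable def gradBound (D lam : ℝ) : ℝ := D * Real.sqrt (1 + D ^ 2 / lam ^ 2)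

/-- The upper bound `min {d^∂, (s - Dmin) / 2}` for the localization radius `δ`. -/
noncomputable def deltaBar {M d : ℕ} (Ω : Set (EuclideanSpace ℝ (Fin d))) (Dmin : ℝ)
    (p : Params M d) : EReal :=
  min ((boundaryDist Ω p.2 : ℝ) : EReal) ((atomSep p.2 - (Dmin : EReal)) / 2)

/-- The step size bound
`min {λ²/(2D²) log ((min_m b_m - τ)/amin), (1/(2D)) min {d^∂ - δ, s - 2δ - Dmin}}`,
where `D` is the diameter of `Ω`. -/
noncomputable def etaRet {M d : ℕ} (Ω : Set (EuclideanSpace ℝ (Fin d))) (amin Dmin lam δ τ : ℝ)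
    (p : Params M d) : EReal :=
  min ((lam ^ 2 / (2 * Metric.diam Ω ^ 2) * Real.log ((minWeight p.1 - τ) / amin) : ℝ) : EReal)
    (((1 / (2 * Metric.diam Ω) : ℝ) : EReal) *
      min ((boundaryDist Ω p.2 - δ : ℝ) : EReal) (atomSep p.2 - ((2 * δ + Dmin : ℝ) : EReal)))

end Constants

end SinkhornSHK

/-!
The first assertion is a log-sum-exp estimate: the energy of a basin minimizer is at most that of
`X i`, hence at most zero, while margin separation bounds the energy from below by
`S_ε(·, X i) - (1/β) log (1 + (N - 1) e^{-βΔ})`.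

The second assertion rests on the differentiability of `OT_ε` along discrete measures. Between
measures with distinct atoms, `OT_ε` is a finite convex problem over density matrices
(`entropicOT_le`, `le_entropicOT`), and the semi-dual functional provides optimal potentials
(`exists_isSchrodinger`). The dual objective at frozen optimal potentials bounds `OT_ε` from below,
and the primal objective at the optimal coupling, corrected by `(a' - a) ⊗ b + a ⊗ (b' - b)` to have
the right marginals, bounds it from above. Both bounds touch `OT_ε` at the base point and have the
same first-order expansion on mass-preserving increments, so `OT_ε` is differentiable
(`exists_hasFDerivWithinAt_entropicOT`); continuity or uniqueness of the optimizers plays no role.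

Consequently the differential of `S_ε(·, X)` has weight components of oscillation at most `D²`,
because potentials inherit the increments of the cost, and location components of norm at most `D`,
being differences of two barycenters of points of `Ω` (`exists_hasFDerivWithinAt_sinkhorn`). By the
symmetry of `OT_ε` it vanishes at `X` (`hasFDerivWithinAt_sinkhorn_self`). At `X i` the differential
of the energy is therefore the softmax average over the other patterns only, whose total softmax
weight `W` is at most `K / (1 + K)` with `K = (N - 1) e^{-βΔ}` (`exists_hasFDerivWithinAt_energy`).

The step size bound keeps the curve `t ↦ Ret(-t η grad E)`, `0 ≤ t ≤ 1`, in the parameter space. The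
relative weight increments are at most `η W D² / λ²` and the displacements at most `η W D`; the
velocity of the weights has the form `a_m (z_m - ∑ a_j z_j)`, so pairing it with the differential of
`S_ε(·, X i)` is a covariance. The mean value inequality (`sinkhorn_retraction_le`) gives the bound
`η W (D² + D⁴ / λ²) = η W G²`.
-/

/-! ### Existence of Schrödinger potentials -/

namespace SinkhornSHK

section Schrodinger

variable {ι κ : Type*} [Fintype ι] [Fintype κ]

/-- `(u, v)` solves the Schrödinger system with weights `a`, `b` and cost matrix `c` (at unit
temperature): the matrix `exp (u_m + v_n - c_mn)` is the density, with respect to `a ⊗ b`, of a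
coupling of `a` and `b`. -/
def IsSchrodinger (a : ι → ℝ) (b : κ → ℝ) (c : ι → κ → ℝ) (u : ι → ℝ) (v : κ → ℝ) : Prop :=
  (∀ m, ∑ n, b n * Real.exp (u m + v n - c m n) = 1) ∧
    ∀ n, ∑ m, a m * Real.exp (u m + v n - c m n) = 1

/-- The negative semi-dual functional of discrete entropic transport: the potential `u` has been
eliminated by maximization. -/
noncomputable def semiDual (a : ι → ℝ) (b : κ → ℝ) (c : ι → κ → ℝ) (v : κ → ℝ) : ℝ :=
  ∑ m, a m * Real.log (∑ n, b n * Real.exp (v n - c m n)) - ∑ n, b n * v n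

variable {a : ι → ℝ} {b : κ → ℝ}

theorem sum_mul_exp_pos [Nonempty κ] (hb : ∀ n, 0 < b n) (w : κ → ℝ) :
    0 < ∑ n, b n * Real.exp (w n) :=
  Finset.sum_pos (fun n _ => mul_pos (hb n) (Real.exp_pos _)) Finset.univ_nonempty

theorem continuous_semiDual [Nonempty κ] (hb : ∀ n, 0 < b n) (c : ι → κ → ℝ) :
    Continuous (semiDual a b c) := by
  unfold semiDual
  refine Continuous.sub (continuous_finsetSum _ fun m _ => ?_) (by fun_prop)
  exact continuous_const.mul
    (Continuous.log (by fun_prop) fun v => (sum_mul_exp_pos hb fun n => v n - c m n).ne')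

theorem semiDual_sub_const [Nonempty κ] (hb : ∀ n, 0 < b n) (hsa : ∑ m, a m = 1)
    (hsb : ∑ n, b n = 1) (c : ι → κ → ℝ) (v : κ → ℝ) (s : ℝ) :
    semiDual a b c (fun n => v n - s) = semiDual a b c v := by
  have h : ∀ m, Real.log (∑ n, b n * Real.exp (v n - s - c m n)) =
      Real.log (∑ n, b n * Real.exp (v n - c m n)) - s := by
    intro m
    have h1 : ∑ n, b n * Real.exp (v n - s - c m n) =
        (∑ n, b n * Real.exp (v n - c m n)) * Real.exp (-s) := by
      rw [Finset.sum_mul]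
      refine Finset.sum_congr rfl fun n _ => ?_
      rw [mul_assoc, ← Real.exp_add]
      congr 2; ring
    rw [h1, Real.log_mul (sum_mul_exp_pos hb fun n => v n - c m n).ne' (Real.exp_pos _).ne',
      Real.log_exp]
    ring
  simp only [semiDual, h, mul_sub, Finset.sum_sub_distrib, ← Finset.sum_mul, hsa, hsb]
  ring

/-- On normalized potentials the semi-dual functional bounds every coordinate from above. -/
theorem le_semiDual_add (ha : ∀ m, 0 < a m) (hb : ∀ n, 0 < b n)
    (hsa : ∑ m, a m = 1) (c : ι → κ → ℝ) {v : κ → ℝ} (hv : ∑ n, b n * v n = 0) (k : κ) :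
    v k ≤ semiDual a b c v + ∑ m, a m * c m k - Real.log (b k) := by
  have h : ∀ m, a m * (Real.log (b k) + (v k - c m k)) ≤
      a m * Real.log (∑ n, b n * Real.exp (v n - c m n)) := by
    intro m
    refine mul_le_mul_of_nonneg_left ?_ (ha m).le
    rw [← Real.log_exp (v k - c m k), ← Real.log_mul (hb k).ne' (Real.exp_pos _).ne']
    refine Real.log_le_log (mul_pos (hb k) (Real.exp_pos _)) ?_
    exact Finset.single_le_sum (f := fun n => b n * Real.exp (v n - c m n))
      (fun n _ => (mul_pos (hb n) (Real.exp_pos _)).le) (Finset.mem_univ k)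
  have h2 := Finset.sum_le_sum fun m (_ : m ∈ Finset.univ) => h m
  simp only [mul_add, mul_sub, Finset.sum_add_distrib, Finset.sum_sub_distrib, ← Finset.sum_mul,
    hsa] at h2
  unfold semiDual
  linarith

/-- The semi-dual functional attains its minimum: it is invariant under constants, and on normalized
potentials its sublevel sets are bounded. -/
theorem exists_forall_semiDual_le [Nonempty κ] (ha : ∀ m, 0 < a m) (hb : ∀ n, 0 < b n)
    (hsa : ∑ m, a m = 1) (hsb : ∑ n, b n = 1) (c : ι → κ → ℝ) :
    ∃ v, ∀ w, semiDual a b c v ≤ semiDual a b c w := by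
  set K : Set (κ → ℝ) := {v | ∑ n, b n * v n = 0 ∧ semiDual a b c v ≤ semiDual a b c 0} with hK
  have hclosed : IsClosed K :=
    (isClosed_eq (by fun_prop) continuous_const).inter
      (isClosed_le (continuous_semiDual hb c) continuous_const)
  set B : κ → ℝ := fun k => semiDual a b c 0 + ∑ m, a m * c m k - Real.log (b k) with hB
  have hup : ∀ v ∈ K, ∀ k, v k ≤ B k := fun v hv k => by
    have h1 := le_semiDual_add ha hb hsa c hv.1 k
    have h2 := hv.2
    simp only [hB]
    linarith
  have hlow : ∀ v ∈ K, ∀ k, -(∑ n, b n * |B n|) / b k ≤ v k := fun v hv k => by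
    rw [div_le_iff₀ (hb k)]
    have h0 : ∑ n, b n * (|B n| - v n) = ∑ n, b n * |B n| := by
      simp only [mul_sub, Finset.sum_sub_distrib, hv.1, sub_zero]
    have h1 : b k * (|B k| - v k) ≤ ∑ n, b n * (|B n| - v n) :=
      Finset.single_le_sum (f := fun n => b n * (|B n| - v n))
        (fun n _ => mul_nonneg (hb n).le
          (sub_nonneg.2 ((hup v hv n).trans (le_abs_self _)))) (Finset.mem_univ k)
    have h2 : 0 ≤ b k * |B k| := mul_nonneg (hb k).le (abs_nonneg _)
    linarith
  have hcomp : IsCompact K :=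
    (isCompact_univ_pi fun k => isCompact_Icc
      (a := -(∑ n, b n * |B n|) / b k) (b := B k)).of_isClosed_subset hclosed
      fun v hv k _ => ⟨hlow v hv k, hup v hv k⟩
  obtain ⟨v, hv, hmin⟩ := hcomp.exists_isMinOn ⟨0, by simp [hK]⟩
    (continuous_semiDual hb c).continuousOn
  refine ⟨v, fun w => ?_⟩
  rw [← semiDual_sub_const hb hsa hsb c w (∑ n, b n * w n)]
  by_cases h : semiDual a b c (fun n => w n - ∑ n, b n * w n) ≤ semiDual a b c 0
  · refine hmin ⟨?_, h⟩
    simp [mul_sub, Finset.sum_sub_distrib, ← Finset.sum_mul, hsb]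
  · exact hv.2.trans (not_le.1 h).le

/-- Schrödinger potentials exist: the first-order condition at a minimizer of the semi-dual
functional is the second half of the Schrödinger system, the first half holds by construction. -/
theorem exists_isSchrodinger [Nonempty κ] (ha : ∀ m, 0 < a m) (hb : ∀ n, 0 < b n)
    (hsa : ∑ m, a m = 1) (hsb : ∑ n, b n = 1) (c : ι → κ → ℝ) :
    ∃ u v, IsSchrodinger a b c u v := by
  classical
  obtain ⟨v, hv⟩ := exists_forall_semiDual_le ha hb hsa hsb c
  set Z : ι → ℝ := fun m => ∑ n, b n * Real.exp (v n - c m n) with hZ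
  have hZpos : ∀ m, 0 < Z m := fun m => sum_mul_exp_pos hb fun n => v n - c m n
  have hexp : ∀ m n, Real.exp (-Real.log (Z m) + v n - c m n) =
      Real.exp (v n - c m n) / Z m := fun m n => by
    rw [show -Real.log (Z m) + v n - c m n = (v n - c m n) - Real.log (Z m) by ring,
      Real.exp_sub, Real.exp_log (hZpos m)]
  refine ⟨fun m => -Real.log (Z m), v, fun m => ?_, fun k => ?_⟩
  · simp only [hexp, ← mul_div_assoc, ← Finset.sum_div]
    exact div_self (hZpos m).ne'
  · have hcoord : ∀ n, HasDerivAt (fun t : ℝ => v n + t * (Pi.single k 1 : κ → ℝ) n)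
        ((Pi.single k 1 : κ → ℝ) n) 0 := fun n => by
      simpa using ((hasDerivAt_id (0 : ℝ)).mul_const ((Pi.single k 1 : κ → ℝ) n)).const_add (v n)
    have hZd : ∀ m, HasDerivAt
        (fun t : ℝ => ∑ n, b n * Real.exp (v n + t * (Pi.single k 1 : κ → ℝ) n - c m n))
        (b k * Real.exp (v k - c m k)) 0 := fun m => by
      have := HasDerivAt.fun_sum (u := Finset.univ) fun n _ =>
        (((hcoord n).sub_const (c m n)).exp.const_mul (b n))
      convert! this using 1
      rw [Finset.sum_eq_single k]
      · simp
      · intro n _ hn; simp [hn]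
      · simp
    have hd : HasDerivAt (fun t : ℝ =>
        semiDual a b c (fun n => v n + t * (Pi.single k 1 : κ → ℝ) n))
        (∑ m, a m * (b k * Real.exp (v k - c m k) / Z m) - b k) 0 := by
      unfold semiDual
      refine HasDerivAt.sub (HasDerivAt.fun_sum fun m _ => HasDerivAt.const_mul _ ?_) ?_
      · have := (hZd m).log (by simpa using (hZpos m).ne')
        simpa [hZ] using this
      · have := HasDerivAt.fun_sum (u := Finset.univ) fun n _ => (hcoord n).const_mul (b n)
        convert! this using 1
        simp [Pi.single_apply]
    have hloc : IsLocalMin (fun t : ℝ =>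
        semiDual a b c (fun n => v n + t * (Pi.single k 1 : κ → ℝ) n)) 0 := by
      refine Filter.Eventually.of_forall fun t => ?_
      simpa using hv _
    have h0 := hloc.hasDerivAt_eq_zero hd
    have h1 : b k * ∑ m, a m * Real.exp (-Real.log (Z m) + v k - c m k) = b k * 1 := by
      rw [Finset.mul_sum, mul_one, ← sub_eq_zero, ← h0]
      congr 1
      refine Finset.sum_congr rfl fun m _ => ?_
      rw [hexp]; ring
    exact mul_left_cancel₀ (hb k).ne' h1

end Schrodinger

end SinkhornSHK

/-! ### Entropic transport between discrete measures as a finite problem -/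

namespace SinkhornSHK

section Discretization

open InformationTheory

variable {d M : ℕ}

local notation "E" => EuclideanSpace ℝ (Fin d)

/-- The matrix of the quadratic costs between the atoms of `p` and those of `q`. -/
noncomputable def atomCost (p q : Params M d) (m n : Fin M) : ℝ := ‖p.2 m - q.2 n‖ ^ 2 / 2

/-- `t` is the density, with respect to the product of the weights of `p` and `q`, of a coupling
of these weights. -/
def IsCouplingDensity (p q : Params M d) (t : Fin M → Fin M → ℝ) : Prop :=
  (∀ m n, 0 ≤ t m n) ∧ (∀ m, ∑ n, q.1 n * t m n = 1) ∧ ∀ n, ∑ m, p.1 m * t m n = 1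

/-- The entropic transport objective of the coupling with density `t`. -/
noncomputable def densityCost (ε : ℝ) (p q : Params M d) (t : Fin M → Fin M → ℝ) : ℝ :=
  ∑ m, ∑ n, p.1 m * q.1 n * (t m n * atomCost p q m n + ε * klFun (t m n))

/-- Positive weights that sum to one and distinct locations. -/
structure IsProper (p : Params M d) : Prop where
  pos : ∀ m, 0 < p.1 m
  sum_eq : ∑ m, p.1 m = 1
  inj : Function.Injective p.2

theorem toMeasure_apply (p : Params M d) {s : Set E} (hs : MeasurableSet s) :
    toMeasure p s = ∑ m, ENNReal.ofReal (p.1 m) * s.indicator 1 (p.2 m) := by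
  simp [toMeasure, Measure.finsetSum_apply, Measure.dirac_apply' _ hs]

theorem toMeasure_singleton {p : Params M d} (hp : IsProper p) (k : Fin M) :
    toMeasure p {p.2 k} = ENNReal.ofReal (p.1 k) := by
  rw [toMeasure_apply p (measurableSet_singleton _), Finset.sum_eq_single k]
  · simp
  · intro m _ hm
    simp [hp.inj.eq_iff, hm]
  · simp

theorem isProbabilityMeasure_toMeasure {p : Params M d} (hp : IsProper p) :
    IsProbabilityMeasure (toMeasure p) := by
  constructor
  rw [toMeasure_apply p MeasurableSet.univ]
  simp [← ENNReal.ofReal_sum_of_nonneg fun m _ => (hp.pos m).le, hp.sum_eq]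

instance (p : Params M d) : IsFiniteMeasure (toMeasure p) := by
  constructor
  rw [toMeasure_apply p MeasurableSet.univ]
  simp [ENNReal.sum_lt_top]

theorem toMeasure_prod (p q : Params M d) :
    (toMeasure p).prod (toMeasure q) = ∑ m, ∑ n,
      (ENNReal.ofReal (p.1 m) * ENNReal.ofReal (q.1 n)) • Measure.dirac (p.2 m, q.2 n) := by
  refine Measure.prod_eq fun s t hs ht => ?_
  rw [toMeasure_apply p hs, toMeasure_apply q ht, Finset.sum_mul_sum]
  simp only [Measure.finsetSum_apply, Measure.smul_apply, Measure.dirac_apply' _ (hs.prod ht),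
    smul_eq_mul]
  refine Finset.sum_congr rfl fun m _ => Finset.sum_congr rfl fun n _ => ?_
  by_cases h1 : p.2 m ∈ s <;> by_cases h2 : q.2 n ∈ t <;> simp [h1, h2]

theorem lintegral_toMeasure_prod (p q : Params M d) (F : E × E → ENNReal) :
    ∫⁻ z, F z ∂(toMeasure p).prod (toMeasure q) = ∑ m, ∑ n,
      ENNReal.ofReal (p.1 m) * ENNReal.ofReal (q.1 n) * F (p.2 m, q.2 n) := by
  simp [toMeasure_prod, lintegral_finsetSum_measure]

theorem densityCost_term_nonneg {p q : Params M d} (hp : IsProper p) (hq : IsProper q) {ε : ℝ}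
    (hε : 0 < ε) {t : Fin M → Fin M → ℝ} (ht : ∀ m n, 0 ≤ t m n) (m n : Fin M) :
    0 ≤ p.1 m * q.1 n * (t m n * atomCost p q m n + ε * klFun (t m n)) := by
  have h1 : 0 ≤ klFun (t m n) := klFun_nonneg (ht m n)
  have h2 : 0 ≤ atomCost p q m n := by unfold atomCost; positivity
  have := ht m n
  have := hp.pos m
  have := hq.pos n
  positivity

theorem densityCost_nonneg {p q : Params M d} (hp : IsProper p) (hq : IsProper q) {ε : ℝ}
    (hε : 0 < ε) {t : Fin M → Fin M → ℝ} (ht : ∀ m n, 0 ≤ t m n) : 0 ≤ densityCost ε p q t :=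
  Finset.sum_nonneg fun m _ => Finset.sum_nonneg fun n _ =>
    densityCost_term_nonneg hp hq hε ht m n

/-- The objective of a coupling with a density is a finite sum over the pairs of atoms. -/
theorem entropicCost_withDensity {p q : Params M d} (hp : IsProper p) (hq : IsProper q) {ε : ℝ}
    (hε : 0 < ε) {ρ : E × E → ENNReal} (hρ : Measurable ρ) {t : Fin M → Fin M → ℝ}
    (ht : ∀ m n, 0 ≤ t m n) (hρt : ∀ m n, ρ (p.2 m, q.2 n) = ENNReal.ofReal (t m n)) :
    entropicCost ε (toMeasure p) (toMeasure q)
      (((toMeasure p).prod (toMeasure q)).withDensity ρ) = ENNReal.ofReal (densityCost ε p q t) := by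
  set R := (toMeasure p).prod (toMeasure q) with hR
  have : IsFiniteMeasure (R.withDensity ρ) := by
    refine isFiniteMeasure_withDensity ?_
    rw [lintegral_toMeasure_prod]
    simp [hρt, ENNReal.sum_eq_top, ENNReal.mul_eq_top]
  have hkl : klDiv (R.withDensity ρ) R =
      ∑ m, ∑ n, ENNReal.ofReal (p.1 m) * ENNReal.ofReal (q.1 n) *
        ENNReal.ofReal (klFun (t m n)) := by
    rw [klDiv_eq_lintegral_klFun_of_ac (withDensity_absolutelyContinuous R ρ),
      lintegral_congr_ae (g := fun z => ENNReal.ofReal (klFun (ρ z).toReal))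
        ((Measure.rnDeriv_withDensity R hρ).mono fun z hz => by simp only [hz]),
      lintegral_toMeasure_prod]
    simp [hρt, ENNReal.toReal_ofReal (ht _ _)]
  unfold entropicCost
  rw [← hR, hkl, lintegral_withDensity_eq_lintegral_mul _ hρ (by fun_prop),
    lintegral_toMeasure_prod, Finset.mul_sum, ← Finset.sum_add_distrib, densityCost,
    ENNReal.ofReal_sum_of_nonneg]
  · refine Finset.sum_congr rfl fun m _ => ?_
    rw [Finset.mul_sum, ← Finset.sum_add_distrib, ENNReal.ofReal_sum_of_nonneg]
    · refine Finset.sum_congr rfl fun n _ => ?_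
      have h1 : 0 ≤ klFun (t m n) := klFun_nonneg (ht m n)
      have h2 : 0 ≤ atomCost p q m n := by unfold atomCost; positivity
      rw [ENNReal.ofReal_mul (mul_nonneg (hp.pos m).le (hq.pos n).le),
        ENNReal.ofReal_mul (hp.pos m).le, ENNReal.ofReal_add (mul_nonneg (ht m n) h2)
        (mul_nonneg hε.le h1), ENNReal.ofReal_mul (ht m n), ENNReal.ofReal_mul hε.le]
      simp only [Pi.mul_apply, hρt, atomCost]
      ring
    · exact fun n _ => densityCost_term_nonneg hp hq hε ht m n
  · exact fun m _ => Finset.sum_nonneg fun n _ => densityCost_term_nonneg hp hq hε ht m n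

/-- Since the atoms are distinct, every matrix is read off at the pairs of atoms from a measurable
function on the product space. -/
theorem exists_measurable_density {p q : Params M d} (hp : IsProper p) (hq : IsProper q)
    (t : Fin M → Fin M → ℝ) : ∃ ρ : E × E → ENNReal, Measurable ρ ∧
      ∀ m n, ρ (p.2 m, q.2 n) = ENNReal.ofReal (t m n) := by
  refine ⟨fun z => ∑ m, ∑ n, Set.indicator {(p.2 m, q.2 n)} (fun _ => ENNReal.ofReal (t m n)) z,
    ?_, fun m n => ?_⟩
  · exact Finset.measurable_fun_sum _ fun m _ => Finset.measurable_fun_sum _ fun n _ =>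
      measurable_const.indicator (measurableSet_singleton _)
  · beta_reduce
    rw [Finset.sum_eq_single m, Finset.sum_eq_single n]
    · simp
    · intro n' _ h
      simp [hq.inj.eq_iff, h.symm]
    · simp
    · intro m' _ h
      simp [hp.inj.eq_iff, h.symm]
    · simp

theorem ofReal_sum_mul_eq {a : Fin M → ℝ} (ha : ∀ m, 0 ≤ a m) {t : Fin M → ℝ}
    (ht : ∀ m, 0 ≤ t m) :
    ∑ m, ENNReal.ofReal (a m) * ENNReal.ofReal (t m) = ENNReal.ofReal (∑ m, a m * t m) := by
  rw [ENNReal.ofReal_sum_of_nonneg fun m _ => mul_nonneg (ha m) (ht m)]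
  exact Finset.sum_congr rfl fun m _ => (ENNReal.ofReal_mul (ha m)).symm

theorem withDensity_mem_couplings {p q : Params M d} (hp : IsProper p) (hq : IsProper q)
    {ρ : E × E → ENNReal} {t : Fin M → Fin M → ℝ} (ht : IsCouplingDensity p q t)
    (hρt : ∀ m n, ρ (p.2 m, q.2 n) = ENNReal.ofReal (t m n)) :
    ((toMeasure p).prod (toMeasure q)).withDensity ρ ∈ couplings (toMeasure p) (toMeasure q) := by
  constructor
  · ext s hs
    rw [Measure.map_apply measurable_fst hs, withDensity_apply _ (measurable_fst hs),
      ← lintegral_indicator (measurable_fst hs), lintegral_toMeasure_prod, toMeasure_apply p hs]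
    refine Finset.sum_congr rfl fun m _ => ?_
    by_cases h : p.2 m ∈ s
    · simp [h, hρt, mul_assoc, ← Finset.mul_sum,
        ofReal_sum_mul_eq (fun n => (hq.pos n).le) (ht.1 m), ht.2.1 m]
    · simp [h]
  · ext s hs
    rw [Measure.map_apply measurable_snd hs, withDensity_apply _ (measurable_snd hs),
      ← lintegral_indicator (measurable_snd hs), lintegral_toMeasure_prod, toMeasure_apply q hs,
      Finset.sum_comm]
    refine Finset.sum_congr rfl fun n _ => ?_
    by_cases h : q.2 n ∈ s
    · have h1 : ∑ m, ENNReal.ofReal (p.1 m) * ENNReal.ofReal (t m n) = 1 := by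
        rw [ofReal_sum_mul_eq (fun m => (hp.pos m).le) (fun m => ht.1 m n), ht.2.2 n,
          ENNReal.ofReal_one]
      calc _ = ENNReal.ofReal (q.1 n) *
            ∑ m, ENNReal.ofReal (p.1 m) * ENNReal.ofReal (t m n) := by
            rw [Finset.mul_sum]
            refine Finset.sum_congr rfl fun m _ => ?_
            simp only [Set.indicator, Set.mem_preimage, h, if_true, hρt]
            ring
        _ = _ := by simp [h, h1]
    · simp [h]

/-- Every coupling of finite objective comes from a density matrix. -/
theorem exists_density_of_coupling {p q : Params M d} (hp : IsProper p) (hq : IsProper q) {ε : ℝ}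
    (hε : 0 < ε) {π : Measure (E × E)} (hπ : π ∈ couplings (toMeasure p) (toMeasure q))
    (hfin : entropicCost ε (toMeasure p) (toMeasure q) π ≠ ⊤) :
    ∃ t, IsCouplingDensity p q t ∧
      entropicCost ε (toMeasure p) (toMeasure q) π = ENNReal.ofReal (densityCost ε p q t) := by
  have := isProbabilityMeasure_toMeasure hp
  set R := (toMeasure p).prod (toMeasure q) with hR
  have hac : π ≪ R := by
    by_contra h
    refine hfin ?_
    unfold entropicCost
    rw [← hR, klDiv_of_not_ac h, ENNReal.mul_top (by simpa using hε), add_top]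
  have : IsFiniteMeasure π := by
    constructor
    have h := congrArg (fun μ => μ Set.univ) hπ.1
    simp only [Measure.map_apply measurable_fst MeasurableSet.univ, Set.preimage_univ,
      measure_univ] at h
    simp [h]
  set ρ := π.rnDeriv R with hρ_def
  have hρ : Measurable ρ := Measure.measurable_rnDeriv π R
  have hwd : R.withDensity ρ = π := Measure.withDensity_rnDeriv_eq π R hac
  -- Evaluating the marginals at single atoms gives the row and column sums of the density.
  have h1 : ∀ m, ∑ n, ENNReal.ofReal (q.1 n) * ρ (p.2 m, q.2 n) = 1 := fun k => by
    have h := congrArg (fun μ => μ {p.2 k}) hπ.1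
    have hms : MeasurableSet (Prod.fst ⁻¹' {p.2 k} : Set (E × E)) :=
      measurable_fst (measurableSet_singleton _)
    rw [Measure.map_apply measurable_fst (measurableSet_singleton _), ← hwd,
      withDensity_apply _ hms, ← lintegral_indicator hms, lintegral_toMeasure_prod,
      toMeasure_singleton hp, Finset.sum_eq_single k] at h
    · simp only [Set.mem_preimage, Set.mem_singleton_iff, Set.indicator_of_mem, mul_assoc,
        ← Finset.mul_sum] at h
      exact (ENNReal.mul_right_inj (by simpa using hp.pos k) ENNReal.ofReal_ne_top).1
        (h.trans (mul_one _).symm)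
    · intro m _ hm
      simp [hp.inj.eq_iff, hm]
    · simp
  have h2 : ∀ n, ∑ m, ENNReal.ofReal (p.1 m) * ρ (p.2 m, q.2 n) = 1 := fun k => by
    have h := congrArg (fun μ => μ {q.2 k}) hπ.2
    have hms : MeasurableSet (Prod.snd ⁻¹' {q.2 k} : Set (E × E)) :=
      measurable_snd (measurableSet_singleton _)
    rw [Measure.map_apply measurable_snd (measurableSet_singleton _), ← hwd,
      withDensity_apply _ hms, ← lintegral_indicator hms, lintegral_toMeasure_prod,
      toMeasure_singleton hq, Finset.sum_comm, Finset.sum_eq_single k] at h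
    · have e : ∀ m, ENNReal.ofReal (p.1 m) * ENNReal.ofReal (q.1 k) * ρ (p.2 m, q.2 k) =
          ENNReal.ofReal (q.1 k) * (ENNReal.ofReal (p.1 m) * ρ (p.2 m, q.2 k)) := fun m => by ring
      simp only [Set.mem_preimage, Set.mem_singleton_iff, Set.indicator_of_mem, e,
        ← Finset.mul_sum] at h
      exact (ENNReal.mul_right_inj (by simpa using hq.pos k) ENNReal.ofReal_ne_top).1
        (h.trans (mul_one _).symm)
    · intro m _ hm
      simp [hq.inj.eq_iff, hm]
    · simp
  have hne : ∀ m n, ρ (p.2 m, q.2 n) ≠ ⊤ := fun m n htop => by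
    have h := h1 m
    have h' : ∑ n, ENNReal.ofReal (q.1 n) * ρ (p.2 m, q.2 n) = ⊤ :=
      ENNReal.sum_eq_top.2 ⟨n, Finset.mem_univ n, by
        rw [htop, ENNReal.mul_top (by simpa using hq.pos n)]⟩
    simp [h'] at h
  refine ⟨fun m n => (ρ (p.2 m, q.2 n)).toReal, ⟨fun _ _ => ENNReal.toReal_nonneg, fun m => ?_,
    fun n => ?_⟩, ?_⟩
  · have h := congrArg ENNReal.toReal (h1 m)
    rw [ENNReal.toReal_sum fun n _ => ENNReal.mul_ne_top ENNReal.ofReal_ne_top (hne m n)] at h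
    simpa [ENNReal.toReal_mul, ENNReal.toReal_ofReal (hq.pos _).le] using h
  · have h := congrArg ENNReal.toReal (h2 n)
    rw [ENNReal.toReal_sum fun m _ => ENNReal.mul_ne_top ENNReal.ofReal_ne_top (hne m n)] at h
    simpa [ENNReal.toReal_mul, ENNReal.toReal_ofReal (hp.pos _).le] using h
  · rw [← entropicCost_withDensity hp hq hε hρ (fun _ _ => ENNReal.toReal_nonneg)
      (fun m n => (ENNReal.ofReal_toReal (hne m n)).symm), ← hR, hwd]

theorem isCouplingDensity_one {p q : Params M d} (hp : IsProper p) (hq : IsProper q) :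
    IsCouplingDensity p q fun _ _ => 1 := by
  refine ⟨fun _ _ => zero_le_one, fun _ => ?_, fun _ => ?_⟩
  · simpa using hq.sum_eq
  · simpa using hp.sum_eq

theorem iInf_entropicCost_le {p q : Params M d} (hp : IsProper p) (hq : IsProper q) {ε : ℝ}
    (hε : 0 < ε) {t : Fin M → Fin M → ℝ} (ht : IsCouplingDensity p q t) :
    ⨅ π ∈ couplings (toMeasure p) (toMeasure q), entropicCost ε (toMeasure p) (toMeasure q) π ≤
      ENNReal.ofReal (densityCost ε p q t) := by
  obtain ⟨ρ, hρ, hρt⟩ := exists_measurable_density hp hq t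
  rw [← entropicCost_withDensity hp hq hε hρ ht.1 hρt]
  exact iInf₂_le _ (withDensity_mem_couplings hp hq ht hρt)

/-- Together with `le_entropicOT`: the entropic transport cost between discrete measures is the
infimum of `densityCost` over coupling densities. -/
theorem entropicOT_le {p q : Params M d} (hp : IsProper p) (hq : IsProper q) {ε : ℝ}
    (hε : 0 < ε) {t : Fin M → Fin M → ℝ} (ht : IsCouplingDensity p q t) :
    entropicOT ε (toMeasure p) (toMeasure q) ≤ densityCost ε p q t :=
  ENNReal.toReal_le_of_le_ofReal (densityCost_nonneg hp hq hε ht.1)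
    (iInf_entropicCost_le hp hq hε ht)

theorem le_entropicOT {p q : Params M d} (hp : IsProper p) (hq : IsProper q) {ε : ℝ}
    (hε : 0 < ε) {c : ℝ} (h : ∀ t, IsCouplingDensity p q t → c ≤ densityCost ε p q t) :
    c ≤ entropicOT ε (toMeasure p) (toMeasure q) := by
  refine (ENNReal.ofReal_le_iff_le_toReal ?_).1 (le_iInf₂ fun π hπ => ?_)
  · exact ne_top_of_le_ne_top ENNReal.ofReal_ne_top
      (iInf_entropicCost_le hp hq hε (isCouplingDensity_one hp hq))
  · by_cases hfin : entropicCost ε (toMeasure p) (toMeasure q) π = ⊤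
    · simp [hfin]
    · obtain ⟨t, ht, heq⟩ := exists_density_of_coupling hp hq hε hπ hfin
      rw [heq]
      exact ENNReal.ofReal_le_ofReal (h t ht)

theorem entropicOT_comm {p q : Params M d} (hp : IsProper p) (hq : IsProper q) {ε : ℝ}
    (hε : 0 < ε) :
    entropicOT ε (toMeasure p) (toMeasure q) = entropicOT ε (toMeasure q) (toMeasure p) := by
  have key : ∀ {p q : Params M d}, IsProper p → IsProper q →
      entropicOT ε (toMeasure p) (toMeasure q) ≤ entropicOT ε (toMeasure q) (toMeasure p) := by
    intro p q hp hq
    refine le_entropicOT hq hp hε fun t ht => ?_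
    have ht' : IsCouplingDensity p q fun m n => t n m := ⟨fun m n => ht.1 n m, ht.2.2, ht.2.1⟩
    refine (entropicOT_le hp hq hε ht').trans_eq ?_
    unfold densityCost
    rw [Finset.sum_comm]
    refine Finset.sum_congr rfl fun n _ => Finset.sum_congr rfl fun m _ => ?_
    rw [atomCost, atomCost, norm_sub_rev, mul_comm (p.1 m)]
  exact le_antisymm (key hp hq) (key hq hp)

end Discretization

end SinkhornSHK

/-! ### Differentiability of the entropic transport cost -/

namespace SinkhornSHK

section Derivative

open InformationTheory Filter Topology

/-- A function squeezed between two functions that touch it at `x` and whose derivatives at `x`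
agree on the increments `y - x`, `y ∈ s`, is differentiable within `s` at `x`. -/
theorem hasFDerivWithinAt_of_squeeze {V : Type*} [NormedAddCommGroup V] [NormedSpace ℝ V]
    {F lo up : V → ℝ} {L L' : V →L[ℝ] ℝ} {s : Set V} {x : V}
    (hlo : HasFDerivWithinAt lo L s x) (hup : HasFDerivWithinAt up L' s x)
    (hL : ∀ y ∈ s, L' (y - x) = L (y - x)) (hloF : ∀ᶠ y in 𝓝[s] x, lo y ≤ F y)
    (hFup : ∀ᶠ y in 𝓝[s] x, F y ≤ up y) (hlox : lo x = F x) (hupx : up x = F x) :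
    HasFDerivWithinAt F L s x := by
  rw [hasFDerivWithinAt_iff_isLittleO] at hlo hup ⊢
  have hsum := hlo.norm_left.add hup.norm_left
  refine (Asymptotics.isBigO_iff.2 ⟨1, ?_⟩).trans_isLittleO hsum
  filter_upwards [hloF, hFup, self_mem_nhdsWithin] with y h1 h2 hy
  rw [hL y hy, hlox, hupx, one_mul]
  simp only [Real.norm_eq_abs]
  refine le_trans ?_ (le_abs_self _)
  rw [abs_le]
  have h3 := neg_abs_le (lo y - F x - L (y - x))
  have h4 := le_abs_self (up y - F x - L (y - x))
  have h5 := abs_nonneg (lo y - F x - L (y - x))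
  have h6 := abs_nonneg (up y - F x - L (y - x))
  constructor <;> linarith

/-- The Fenchel-Young inequality for `klFun`. -/
theorem mul_sub_exp_le_klFun {t : ℝ} (ht : 0 ≤ t) (s : ℝ) :
    t * s - (Real.exp s - 1) ≤ klFun t := by
  rw [klFun_apply]
  rcases ht.eq_or_lt with rfl | ht
  · have := Real.exp_pos s
    simp only [zero_mul]
    linarith
  · have h := Real.log_le_sub_one_of_pos (div_pos (Real.exp_pos s) ht)
    rw [Real.log_div (Real.exp_pos s).ne' ht.ne', Real.log_exp] at h
    have h' := mul_le_mul_of_nonneg_left h ht.le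
    rw [mul_sub, mul_sub, mul_div_cancel₀ _ ht.ne'] at h'
    linarith

variable {d M : ℕ}

/-- The Gibbs density `exp (u_m + v_n - c_mn / ε)` of the potentials `ε u`, `ε v`. -/
noncomputable def gibbs (ε : ℝ) (u v : Fin M → ℝ) (p q : Params M d) (m n : Fin M) : ℝ :=
  Real.exp (u m + v n - atomCost p q m n / ε)

/-- The dual entropic transport objective of the potentials `ε u`, `ε v`. -/
noncomputable def dualCost (ε : ℝ) (u v : Fin M → ℝ) (p q : Params M d) : ℝ :=
  ε * (∑ m, p.1 m * u m + ∑ n, q.1 n * v n -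
    ∑ m, ∑ n, p.1 m * q.1 n * (gibbs ε u v p q m n - 1))

/-- `ε u`, `ε v` are optimal dual potentials for the entropic transport from `p` to `q`. -/
def IsPotential (ε : ℝ) (p q : Params M d) (u v : Fin M → ℝ) : Prop :=
  IsSchrodinger p.1 q.1 (fun m n => atomCost p q m n / ε) u v

theorem exists_isPotential {p q : Params M d} (hp : IsProper p) (hq : IsProper q) (ε : ℝ) :
    ∃ u v, IsPotential ε p q u v := by
  have : Nonempty (Fin M) := by
    by_contra h
    have := not_nonempty_iff.1 h
    simpa using hp.sum_eq
  exact exists_isSchrodinger hp.pos hq.pos hp.sum_eq hq.sum_eq _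

theorem IsPotential.isCouplingDensity {ε : ℝ} {p q : Params M d} {u v : Fin M → ℝ}
    (h : IsPotential ε p q u v) : IsCouplingDensity p q (gibbs ε u v p q) :=
  ⟨fun _ _ => (Real.exp_pos _).le, h.1, h.2⟩

theorem IsCouplingDensity.sum_left {p q : Params M d} {t : Fin M → Fin M → ℝ}
    (ht : IsCouplingDensity p q t) (w : Fin M → ℝ) :
    ∑ m, ∑ n, p.1 m * q.1 n * (t m n * w m) = ∑ m, p.1 m * w m := by
  refine Finset.sum_congr rfl fun m _ => ?_
  have h : ∀ n, p.1 m * q.1 n * (t m n * w m) = p.1 m * w m * (q.1 n * t m n) := fun n => by ring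
  simp only [h, ← Finset.mul_sum, ht.2.1, mul_one]

theorem IsCouplingDensity.sum_right {p q : Params M d} {t : Fin M → Fin M → ℝ}
    (ht : IsCouplingDensity p q t) (w : Fin M → ℝ) :
    ∑ m, ∑ n, p.1 m * q.1 n * (t m n * w n) = ∑ n, q.1 n * w n := by
  rw [Finset.sum_comm]
  refine Finset.sum_congr rfl fun n _ => ?_
  have h : ∀ m, p.1 m * q.1 n * (t m n * w n) = q.1 n * w n * (p.1 m * t m n) := fun m => by ring
  simp only [h, ← Finset.mul_sum, ht.2.2, mul_one]

theorem IsCouplingDensity.sum_mul_sub_one_left {p q : Params M d} {t : Fin M → Fin M → ℝ}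
    (ht : IsCouplingDensity p q t) (hq : IsProper q) (w : Fin M → ℝ) :
    ∑ m, ∑ n, w m * q.1 n * (t m n - 1) = 0 := by
  refine Finset.sum_eq_zero fun m _ => ?_
  simp only [mul_assoc, mul_sub, ← Finset.mul_sum, Finset.sum_sub_distrib, ht.2.1 m, mul_one,
    hq.sum_eq, sub_self]

theorem IsCouplingDensity.sum_mul_sub_one_right {p q : Params M d} {t : Fin M → Fin M → ℝ}
    (ht : IsCouplingDensity p q t) (hp : IsProper p) (w : Fin M → ℝ) :
    ∑ m, ∑ n, p.1 m * w n * (t m n - 1) = 0 := by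
  rw [Finset.sum_comm]
  refine Finset.sum_eq_zero fun n _ => ?_
  have e : ∀ m, p.1 m * w n * (t m n - 1) = w n * (p.1 m * t m n - p.1 m) := fun m => by ring
  simp only [e, ← Finset.mul_sum, Finset.sum_sub_distrib, ht.2.2 n, hp.sum_eq, sub_self, mul_zero]

/-- Weak duality. -/
theorem dualCost_le_densityCost {p q : Params M d} (hp : IsProper p) (hq : IsProper q) {ε : ℝ}
    (hε : 0 < ε) (u v : Fin M → ℝ) {t : Fin M → Fin M → ℝ} (ht : IsCouplingDensity p q t) :
    dualCost ε u v p q ≤ densityCost ε p q t := by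
  rw [dualCost, ← ht.sum_left u, ← ht.sum_right v, densityCost]
  simp only [← Finset.sum_add_distrib, ← Finset.sum_sub_distrib, Finset.mul_sum]
  refine Finset.sum_le_sum fun m _ => Finset.sum_le_sum fun n _ => ?_
  have h := mul_le_mul_of_nonneg_left
    (mul_sub_exp_le_klFun (ht.1 m n) (u m + v n - atomCost p q m n / ε)) hε.le
  have hc : ε * (atomCost p q m n / ε) = atomCost p q m n := mul_div_cancel₀ _ hε.ne'
  have h' : ε * (t m n * (u m + v n) - (gibbs ε u v p q m n - 1)) ≤
      t m n * atomCost p q m n + ε * klFun (t m n) := by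
    unfold gibbs
    have : t m n * (ε * (atomCost p q m n / ε)) = t m n * atomCost p q m n := by rw [hc]
    linarith
  have h'' := mul_le_mul_of_nonneg_left h' (mul_nonneg (hp.pos m).le (hq.pos n).le)
  linarith

/-- The Gibbs density of optimal potentials attains the dual value, so that there is no duality
gap. -/
theorem densityCost_gibbs {p q : Params M d} {ε : ℝ} (hε : 0 < ε) {u v : Fin M → ℝ}
    (h : IsPotential ε p q u v) :
    densityCost ε p q (gibbs ε u v p q) = dualCost ε u v p q := by
  have ht := h.isCouplingDensity
  rw [dualCost, ← ht.sum_left u, ← ht.sum_right v, densityCost]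
  simp only [← Finset.sum_add_distrib, ← Finset.sum_sub_distrib, Finset.mul_sum]
  refine Finset.sum_congr rfl fun m _ => Finset.sum_congr rfl fun n _ => ?_
  rw [klFun_apply]
  nth_rw 3 [gibbs]
  rw [Real.log_exp]
  field_simp
  ring

theorem dualCost_le_entropicOT {p q : Params M d} (hp : IsProper p) (hq : IsProper q) {ε : ℝ}
    (hε : 0 < ε) (u v : Fin M → ℝ) :
    dualCost ε u v p q ≤ entropicOT ε (toMeasure p) (toMeasure q) :=
  le_entropicOT hp hq hε fun _ ht => dualCost_le_densityCost hp hq hε u v ht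

theorem entropicOT_eq_dualCost {p q : Params M d} (hp : IsProper p) (hq : IsProper q) {ε : ℝ}
    (hε : 0 < ε) {u v : Fin M → ℝ} (h : IsPotential ε p q u v) :
    entropicOT ε (toMeasure p) (toMeasure q) = dualCost ε u v p q :=
  le_antisymm ((entropicOT_le hp hq hε h.isCouplingDensity).trans_eq (densityCost_gibbs hε h))
    (dualCost_le_entropicOT hp hq hε u v)

/-- The coupling of the weights of `p'` and `q'` obtained from the optimal coupling of `p` and `q`
by adding `(a' - a) ⊗ b + a ⊗ (b' - b)`. -/
noncomputable def movedCoupling (ε : ℝ) (u v : Fin M → ℝ) (p q p' q' : Params M d)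
    (m n : Fin M) : ℝ :=
  p.1 m * q.1 n * gibbs ε u v p q m n + (p'.1 m - p.1 m) * q.1 n + p.1 m * (q'.1 n - q.1 n)

/-- The primal objective of `movedCoupling`. -/
noncomputable def movedCost (ε : ℝ) (u v : Fin M → ℝ) (p q p' q' : Params M d) : ℝ :=
  ∑ m, ∑ n, (movedCoupling ε u v p q p' q' m n * atomCost p' q' m n +
    ε * (movedCoupling ε u v p q p' q' m n *
      (Real.log (movedCoupling ε u v p q p' q' m n) - Real.log (p'.1 m) - Real.log (q'.1 n)) +
      p'.1 m * q'.1 n - movedCoupling ε u v p q p' q' m n))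

theorem movedCoupling_self (ε : ℝ) (u v : Fin M → ℝ) (p q : Params M d) (m n : Fin M) :
    movedCoupling ε u v p q p q m n = p.1 m * q.1 n * gibbs ε u v p q m n := by
  simp [movedCoupling]

theorem densityCost_div_eq {p q : Params M d} (hp : IsProper p) (hq : IsProper q) (ε : ℝ)
    {P : Fin M → Fin M → ℝ} (hP : ∀ m n, 0 < P m n) :
    densityCost ε p q (fun m n => P m n / (p.1 m * q.1 n)) =
      ∑ m, ∑ n, (P m n * atomCost p q m n + ε * (P m n *
        (Real.log (P m n) - Real.log (p.1 m) - Real.log (q.1 n)) + p.1 m * q.1 n - P m n)) := by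
  refine Finset.sum_congr rfl fun m _ => Finset.sum_congr rfl fun n _ => ?_
  have h1 := (hp.pos m).ne'
  have h2 := (hq.pos n).ne'
  rw [klFun_apply, Real.log_div (hP m n).ne' (mul_ne_zero h1 h2), Real.log_mul h1 h2]
  field_simp
  ring

theorem isCouplingDensity_moved {ε : ℝ} {u v : Fin M → ℝ} {p q p' q' : Params M d}
    (hp : IsProper p) (hq : IsProper q) (hp' : IsProper p') (hq' : IsProper q')
    (h : IsPotential ε p q u v) (hpos : ∀ m n, 0 < movedCoupling ε u v p q p' q' m n) :
    IsCouplingDensity p' q'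
      (fun m n => movedCoupling ε u v p q p' q' m n / (p'.1 m * q'.1 n)) := by
  refine ⟨fun m n => (div_pos (hpos m n) (mul_pos (hp'.pos m) (hq'.pos n))).le, fun m => ?_,
    fun n => ?_⟩
  · have e : ∀ n, q'.1 n * (movedCoupling ε u v p q p' q' m n / (p'.1 m * q'.1 n)) =
        (p.1 m * (q.1 n * gibbs ε u v p q m n) + (p'.1 m - p.1 m) * q.1 n +
          p.1 m * (q'.1 n - q.1 n)) / p'.1 m := fun n => by
      have := (hq'.pos n).ne'
      have := (hp'.pos m).ne'
      rw [movedCoupling]; field_simp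
    simp only [e, ← Finset.sum_div, Finset.sum_add_distrib, ← Finset.mul_sum,
      Finset.sum_sub_distrib, h.isCouplingDensity.2.1 m, hq.sum_eq, hq'.sum_eq]
    rw [div_eq_one_iff_eq (hp'.pos m).ne']
    ring
  · have e : ∀ m, p'.1 m * (movedCoupling ε u v p q p' q' m n / (p'.1 m * q'.1 n)) =
        (q.1 n * (p.1 m * gibbs ε u v p q m n) + (p'.1 m - p.1 m) * q.1 n +
          p.1 m * (q'.1 n - q.1 n)) / q'.1 n := fun m => by
      have := (hq'.pos n).ne'
      have := (hp'.pos m).ne'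
      rw [movedCoupling]; field_simp
    simp only [e, ← Finset.sum_div, Finset.sum_add_distrib, ← Finset.mul_sum, ← Finset.sum_mul,
      Finset.sum_sub_distrib, h.isCouplingDensity.2.2 n, hp.sum_eq, hp'.sum_eq]
    rw [div_eq_one_iff_eq (hq'.pos n).ne']
    ring

theorem entropicOT_le_movedCost {ε : ℝ} (hε : 0 < ε) {u v : Fin M → ℝ} {p q p' q' : Params M d}
    (hp : IsProper p) (hq : IsProper q) (hp' : IsProper p') (hq' : IsProper q')
    (h : IsPotential ε p q u v) (hpos : ∀ m n, 0 < movedCoupling ε u v p q p' q' m n) :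
    entropicOT ε (toMeasure p') (toMeasure q') ≤ movedCost ε u v p q p' q' :=
  (entropicOT_le hp' hq' hε (isCouplingDensity_moved hp hq hp' hq' h hpos)).trans_eq
    (densityCost_div_eq hp' hq' ε hpos)

theorem movedCost_self {ε : ℝ} (hε : 0 < ε) {u v : Fin M → ℝ} {p q : Params M d}
    (hp : IsProper p) (hq : IsProper q) (h : IsPotential ε p q u v) :
    movedCost ε u v p q p q = entropicOT ε (toMeasure p) (toMeasure q) := by
  have hpos : ∀ m n, 0 < movedCoupling ε u v p q p q m n := fun m n => by
    rw [movedCoupling_self]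
    exact mul_pos (mul_pos (hp.pos m) (hq.pos n)) (Real.exp_pos _)
  rw [entropicOT_eq_dualCost hp hq hε h, ← densityCost_gibbs hε h, movedCost,
    ← densityCost_div_eq hp hq ε hpos]
  congr 1
  funext m n
  rw [movedCoupling_self, mul_div_cancel_left₀ _ (mul_pos (hp.pos m) (hq.pos n)).ne']

/-- The differential of the entropic transport cost: the potentials act on the weight increments,
the optimal coupling on the increments of the locations. -/
noncomputable def otDifferential (ε : ℝ) (u v : Fin M → ℝ) (p q δp δq : Params M d) : ℝ :=
  ε * ∑ m, δp.1 m * u m + ε * ∑ n, δq.1 n * v n +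
    ∑ m, ∑ n, p.1 m * q.1 n * gibbs ε u v p q m n *
      inner ℝ (p.2 m - q.2 n) (δp.2 m - δq.2 n)

theorem differentiable_atomCost (m n : Fin M) :
    Differentiable ℝ fun z : Params M d × Params M d => atomCost z.1 z.2 m n := by
  unfold atomCost
  have h : Differentiable ℝ fun z : Params M d × Params M d => z.1.2 m - z.2.2 n := by fun_prop
  simpa only [div_eq_mul_inv] using (h.norm_sq ℝ).mul_const (2 : ℝ)⁻¹

theorem hasDerivAt_line_fst (p δp : Params M d) (m : Fin M) :
    HasDerivAt (fun t : ℝ => (p + t • δp).1 m) (δp.1 m) 0 := by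
  simpa using ((hasDerivAt_id (0 : ℝ)).mul_const (δp.1 m)).const_add (p.1 m)

theorem hasDerivAt_line_atomCost (p q δp δq : Params M d) (m n : Fin M) :
    HasDerivAt (fun t : ℝ => atomCost (p + t • δp) (q + t • δq) m n)
      (inner ℝ (p.2 m - q.2 n) (δp.2 m - δq.2 n)) 0 := by
  have h : ∀ (p δp : Params M d) (m : Fin M),
      HasDerivAt (fun t : ℝ => (p + t • δp).2 m) (δp.2 m) 0 := fun p δp m => by
    simpa using ((hasDerivAt_id (0 : ℝ)).smul_const (δp.2 m)).const_add (p.2 m)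
  have := (((h p δp m).sub (h q δq n)).norm_sq).div_const 2
  convert! this using 1
  simp

theorem differentiableAt_dualCost (ε : ℝ) (u v : Fin M → ℝ) (z : Params M d × Params M d) :
    DifferentiableAt ℝ (fun z : Params M d × Params M d => dualCost ε u v z.1 z.2) z := by
  unfold dualCost gibbs
  have h := fun m n => (differentiable_atomCost (d := d) (M := M) m n) z
  fun_prop (disch := assumption)

/-- Only the explicit dependence on weights and locations contributes; the exponential term drops
out of the weight derivatives by the Schrödinger system. -/
theorem fderiv_dualCost {ε : ℝ} (hε : 0 < ε) {u v : Fin M → ℝ} {p q : Params M d}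
    (hp : IsProper p) (hq : IsProper q) (h : IsPotential ε p q u v) (w : Params M d × Params M d) :
    fderiv ℝ (fun z : Params M d × Params M d => dualCost ε u v z.1 z.2) (p, q) w =
      otDifferential ε u v p q w.1 w.2 := by
  have ht := h.isCouplingDensity
  have hline : HasDerivAt (fun t : ℝ => (p, q) + t • w) w 0 := by
    simpa using ((hasDerivAt_id (0 : ℝ)).smul_const w).const_add (p, q)
  have h1 : HasDerivAt (fun t : ℝ => dualCost ε u v ((p, q) + t • w).1 ((p, q) + t • w).2)
      (fderiv ℝ (fun z : Params M d × Params M d => dualCost ε u v z.1 z.2) (p, q) w) 0 := by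
    exact HasFDerivAt.comp_hasDerivAt_of_eq (f := fun t : ℝ => (p, q) + t • w) 0
      (differentiableAt_dualCost ε u v (p, q)).hasFDerivAt hline (by simp)
  have hg : ∀ m n, HasDerivAt (fun t : ℝ => gibbs ε u v (p + t • w.1) (q + t • w.2) m n)
      (gibbs ε u v p q m n * -(inner ℝ (p.2 m - q.2 n) (w.1.2 m - w.2.2 n) / ε)) 0 :=
    fun m n => by
      have := (((hasDerivAt_line_atomCost p q w.1 w.2 m n).div_const ε).const_sub (u m + v n)).exp
      simpa [gibbs] using this
  have h2 : HasDerivAt (fun t : ℝ => dualCost ε u v (p + t • w.1) (q + t • w.2))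
      (otDifferential ε u v p q w.1 w.2) 0 := by
    unfold dualCost
    have := (((HasDerivAt.fun_sum fun m (_ : m ∈ Finset.univ) =>
      (hasDerivAt_line_fst p w.1 m).mul_const (u m)).add
      (HasDerivAt.fun_sum fun n (_ : n ∈ Finset.univ) =>
      (hasDerivAt_line_fst q w.2 n).mul_const (v n))).sub
      (HasDerivAt.fun_sum fun m (_ : m ∈ Finset.univ) =>
        HasDerivAt.fun_sum fun n (_ : n ∈ Finset.univ) =>
        ((hasDerivAt_line_fst p w.1 m).mul (hasDerivAt_line_fst q w.2 n)).mul
          ((hg m n).sub_const 1))).const_mul ε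
    convert! this using 1
    simp only [zero_smul, add_zero, Pi.mul_apply]
    have e1 := ht.sum_mul_sub_one_left hq w.1.1
    have e2 := ht.sum_mul_sub_one_right hp w.2.1
    have e3 : ∀ m n, (w.1.1 m * q.1 n + p.1 m * w.2.1 n) * (gibbs ε u v p q m n - 1) +
        p.1 m * q.1 n *
          (gibbs ε u v p q m n * -(inner ℝ (p.2 m - q.2 n) (w.1.2 m - w.2.2 n) / ε)) =
        w.1.1 m * q.1 n * (gibbs ε u v p q m n - 1) +
        p.1 m * w.2.1 n * (gibbs ε u v p q m n - 1) -
        ε⁻¹ * (p.1 m * q.1 n * gibbs ε u v p q m n *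
          inner ℝ (p.2 m - q.2 n) (w.1.2 m - w.2.2 n)) := fun m n => by
      field_simp
      ring
    simp only [e3, Finset.sum_add_distrib, Finset.sum_sub_distrib, e1, e2, ← Finset.mul_sum]
    rw [otDifferential]
    field_simp
    ring
  exact h1.unique h2

/-- On increments that preserve the total mass, the primal upper bound has the same derivative as
the dual lower bound. -/
theorem exists_hasFDerivAt_movedCost {ε : ℝ} (hε : 0 < ε) {u v : Fin M → ℝ} {p q : Params M d}
    (hp : IsProper p) (hq : IsProper q) (h : IsPotential ε p q u v) :
    ∃ L : Params M d × Params M d →L[ℝ] ℝ,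
      HasFDerivAt (fun z : Params M d × Params M d => movedCost ε u v p q z.1 z.2) L (p, q) ∧
      ∀ w, w.1 ∈ tangent M d → w.2 ∈ tangent M d → L w = otDifferential ε u v p q w.1 w.2 := by
  have ht := h.isCouplingDensity
  have hpos : ∀ m n, 0 < movedCoupling ε u v p q p q m n := fun m n => by
    rw [movedCoupling_self]
    exact mul_pos (mul_pos (hp.pos m) (hq.pos n)) (Real.exp_pos _)
  have hdiff : DifferentiableAt ℝ
      (fun z : Params M d × Params M d => movedCost ε u v p q z.1 z.2) (p, q) := by
    unfold movedCost
    have h0 := fun m n => (differentiable_atomCost (d := d) (M := M) m n) (p, q)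
    have h1 : ∀ m n, DifferentiableAt ℝ (fun z : Params M d × Params M d =>
        movedCoupling ε u v p q z.1 z.2 m n) (p, q) := fun m n => by
      unfold movedCoupling; fun_prop
    have h2 := fun m n => (h1 m n).log (hpos m n).ne'
    have h3 : ∀ m, DifferentiableAt ℝ (fun z : Params M d × Params M d => Real.log (z.1.1 m))
        (p, q) := fun m => DifferentiableAt.log (by fun_prop) (hp.pos m).ne'
    have h4 : ∀ n, DifferentiableAt ℝ (fun z : Params M d × Params M d => Real.log (z.2.1 n))
        (p, q) := fun n => DifferentiableAt.log (by fun_prop) (hq.pos n).ne'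
    fun_prop (disch := assumption)
  refine ⟨_, hdiff.hasFDerivAt, fun w hw1 hw2 => ?_⟩
  have hline : HasDerivAt (fun t : ℝ => (p, q) + t • w) w 0 := by
    simpa using ((hasDerivAt_id (0 : ℝ)).smul_const w).const_add (p, q)
  have h1 : HasDerivAt (fun t : ℝ => movedCost ε u v p q (p + t • w.1) (q + t • w.2))
      (fderiv ℝ (fun z : Params M d × Params M d => movedCost ε u v p q z.1 z.2) (p, q) w) 0 := by
    refine HasFDerivAt.comp_hasDerivAt_of_eq (f := fun t : ℝ => (p, q) + t • w) 0
      hdiff.hasFDerivAt hline (by simp)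
  have hP : ∀ m n, HasDerivAt
      (fun t : ℝ => movedCoupling ε u v p q (p + t • w.1) (q + t • w.2) m n)
      (w.1.1 m * q.1 n + p.1 m * w.2.1 n) 0 := fun m n => by
    unfold movedCoupling
    have := ((((hasDerivAt_line_fst p w.1 m).sub_const (p.1 m)).mul_const (q.1 n)).const_add
      (p.1 m * q.1 n * gibbs ε u v p q m n)).add
      (((hasDerivAt_line_fst q w.2 n).sub_const (q.1 n)).const_mul (p.1 m))
    exact this
  have h2 : HasDerivAt (fun t : ℝ => movedCost ε u v p q (p + t • w.1) (q + t • w.2))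
      (otDifferential ε u v p q w.1 w.2) 0 := by
    unfold movedCost
    have := HasDerivAt.fun_sum fun m (_ : m ∈ Finset.univ) =>
        HasDerivAt.fun_sum fun n (_ : n ∈ Finset.univ) =>
        ((hP m n).mul (hasDerivAt_line_atomCost p q w.1 w.2 m n)).add
          (((((hP m n).mul ((((hP m n).log (by simpa using (hpos m n).ne')).sub
            ((hasDerivAt_line_fst p w.1 m).log (by simpa using (hp.pos m).ne'))).sub
            ((hasDerivAt_line_fst q w.2 n).log (by simpa using (hq.pos n).ne')))).add
            ((hasDerivAt_line_fst p w.1 m).mul (hasDerivAt_line_fst q w.2 n))).sub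
            (hP m n)).const_mul ε)
    convert! this using 1
    simp only [zero_smul, add_zero, movedCoupling_self, Pi.sub_apply]
    have e1 := ht.sum_mul_sub_one_left hq w.1.1
    have e2 := ht.sum_mul_sub_one_right hp w.2.1
    have e3 : ∀ m n, Real.log (p.1 m * q.1 n * gibbs ε u v p q m n) - Real.log (p.1 m) -
        Real.log (q.1 n) = u m + v n - atomCost p q m n / ε := fun m n => by
      rw [gibbs, Real.log_mul (mul_pos (hp.pos m) (hq.pos n)).ne' (Real.exp_pos _).ne',
        Real.log_mul (hp.pos m).ne' (hq.pos n).ne', Real.log_exp]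
      ring
    have e4 : ∀ m n, (w.1.1 m * q.1 n + p.1 m * w.2.1 n) * atomCost p q m n +
        p.1 m * q.1 n * gibbs ε u v p q m n * inner ℝ (p.2 m - q.2 n) (w.1.2 m - w.2.2 n) +
        ε * ((w.1.1 m * q.1 n + p.1 m * w.2.1 n) * (u m + v n - atomCost p q m n / ε) +
          p.1 m * q.1 n * gibbs ε u v p q m n *
            ((w.1.1 m * q.1 n + p.1 m * w.2.1 n) / (p.1 m * q.1 n * gibbs ε u v p q m n) -
              w.1.1 m / p.1 m - w.2.1 n / q.1 n) +
          (w.1.1 m * q.1 n + p.1 m * w.2.1 n) - (w.1.1 m * q.1 n + p.1 m * w.2.1 n)) =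
        p.1 m * q.1 n * gibbs ε u v p q m n * inner ℝ (p.2 m - q.2 n) (w.1.2 m - w.2.2 n) +
        ε * (w.1.1 m * u m * q.1 n + w.1.1 m * (q.1 n * v n) + p.1 m * u m * w.2.1 n +
          p.1 m * (w.2.1 n * v n)) - ε * (w.1.1 m * q.1 n * (gibbs ε u v p q m n - 1)) -
        ε * (p.1 m * w.2.1 n * (gibbs ε u v p q m n - 1)) := fun m n => by
      have h1 := (hp.pos m).ne'
      have h2 := (hq.pos n).ne'
      have h3 : gibbs ε u v p q m n ≠ 0 := (Real.exp_pos _).ne'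
      field_simp
      ring
    simp only [e3, e4]
    simp only [Finset.sum_add_distrib, Finset.sum_sub_distrib, ← Finset.mul_sum, e1, e2,
      ← Finset.sum_mul, hq.sum_eq, hp.sum_eq, show ∑ m, w.1.1 m = 0 from hw1,
      show ∑ n, w.2.1 n = 0 from hw2]
    rw [otDifferential]
    ring
  exact h1.unique h2

theorem IsProper.sub_mem_tangent {p p' : Params M d} (hp : IsProper p) (hp' : IsProper p') :
    p' - p ∈ tangent M d := by
  simp [tangent, hp.sum_eq, hp'.sum_eq]

/-- The entropic transport cost is differentiable along pairs of discrete measures, and its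
differential is that of the dual objective at fixed optimal potentials. Freezing the potentials
bounds the cost from below, moving the optimal coupling bounds it from above, and both bounds have
the same first-order expansion; no regularity of the optimizers is needed. -/
theorem exists_hasFDerivWithinAt_entropicOT {ε : ℝ} (hε : 0 < ε) {u v : Fin M → ℝ}
    {p q : Params M d} (hp : IsProper p) (hq : IsProper q) (h : IsPotential ε p q u v) :
    ∃ L : Params M d × Params M d →L[ℝ] ℝ,
      HasFDerivWithinAt
        (fun z : Params M d × Params M d => entropicOT ε (toMeasure z.1) (toMeasure z.2)) L
        {z | IsProper z.1 ∧ IsProper z.2} (p, q) ∧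
      ∀ w, L w = otDifferential ε u v p q w.1 w.2 := by
  obtain ⟨L', hL', hL'w⟩ := exists_hasFDerivAt_movedCost hε hp hq h
  refine ⟨_, hasFDerivWithinAt_of_squeeze
    (differentiableAt_dualCost ε u v (p, q)).hasFDerivAt.hasFDerivWithinAt
    hL'.hasFDerivWithinAt (fun z hz => ?_) ?_ ?_ (entropicOT_eq_dualCost hp hq hε h).symm
    (movedCost_self hε hp hq h), fderiv_dualCost hε hp hq h⟩
  · rw [fderiv_dualCost hε hp hq h]
    exact hL'w _ (hp.sub_mem_tangent hz.1) (hq.sub_mem_tangent hz.2)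
  · filter_upwards [self_mem_nhdsWithin] with z hz
    exact dualCost_le_entropicOT hz.1 hz.2 hε u v
  · have hpos : ∀ᶠ z : Params M d × Params M d in 𝓝 (p, q),
        ∀ m n, 0 < movedCoupling ε u v p q z.1 z.2 m n := by
      refine eventually_all.2 fun m => eventually_all.2 fun n => ?_
      have hc : Continuous fun z : Params M d × Params M d =>
          movedCoupling ε u v p q z.1 z.2 m n := by
        unfold movedCoupling; fun_prop
      refine hc.continuousAt.eventually_const_lt ?_
      simp only [movedCoupling_self]
      exact mul_pos (mul_pos (hp.pos m) (hq.pos n)) (Real.exp_pos _)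
    filter_upwards [self_mem_nhdsWithin, hpos.filter_mono nhdsWithin_le_nhds] with z hz hz'
    exact entropicOT_le_movedCost hε hp hq hz.1 hz.2 h hz'

end Derivative

end SinkhornSHK

/-! ### The differential of the Sinkhorn divergence -/

namespace SinkhornSHK

section SinkhornDerivative

open Filter Topology

variable {d M : ℕ} {Ω : Set (EuclideanSpace ℝ (Fin d))} {amin Dmin : ℝ}

theorem isProper_of_mem_paramSpace (hamin : 0 < amin) (hDmin : 0 < Dmin) {p : Params M d}
    (hp : p ∈ paramSpace M Ω amin Dmin) : IsProper p where
  pos m := hamin.trans (hp.1 m)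
  sum_eq := hp.2.1
  inj m n h := by
    by_contra hmn
    have := hp.2.2.2 m n hmn
    rw [h, sub_self, norm_zero] at this
    exact this.not_gt hDmin

/-- The parameter space is relatively open in the hyperplane of weights that sum to one. -/
theorem eventually_mem_paramSpace (hΩ : IsOpen Ω) {p : Params M d}
    (hp : p ∈ paramSpace M Ω amin Dmin) :
    ∀ᶠ p' in 𝓝 p, ∑ m, p'.1 m = 1 → p' ∈ paramSpace M Ω amin Dmin := by
  have h1 : ∀ᶠ p' : Params M d in 𝓝 p, ∀ m, amin < p'.1 m := eventually_all.2 fun m =>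
    have hc : Continuous fun p' : Params M d => p'.1 m := by fun_prop
    hc.continuousAt.eventually_const_lt (hp.1 m)
  have h2 : ∀ᶠ p' : Params M d in 𝓝 p, ∀ m, p'.2 m ∈ Ω := eventually_all.2 fun m =>
    ContinuousAt.eventually_mem (f := fun p' : Params M d => p'.2 m) (by fun_prop)
      (hΩ.mem_nhds (hp.2.2.1 m))
  have h3 : ∀ᶠ p' : Params M d in 𝓝 p, ∀ m n, m ≠ n → Dmin < ‖p'.2 m - p'.2 n‖ :=
    eventually_all.2 fun m => eventually_all.2 fun n => eventually_imp_distrib_left.2 fun hmn =>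
      have hc : Continuous fun p' : Params M d => ‖p'.2 m - p'.2 n‖ := by fun_prop
      hc.continuousAt.eventually_const_lt (hp.2.2.2 m n hmn)
  filter_upwards [h1, h2, h3] with p' h1 h2 h3 hs
  exact ⟨h1, hs, h2, h3⟩

theorem eventually_line_mem_paramSpace (hΩ : IsOpen Ω) {p w : Params M d}
    (hp : p ∈ paramSpace M Ω amin Dmin) (hw : w ∈ tangent M d) :
    ∀ᶠ t : ℝ in 𝓝 0, p + t • w ∈ paramSpace M Ω amin Dmin := by
  have hc : Tendsto (fun t : ℝ => p + t • w) (𝓝 0) (𝓝 p) := by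
    have : Continuous fun t : ℝ => p + t • w := by fun_prop
    simpa using this.tendsto 0
  filter_upwards [hc.eventually (eventually_mem_paramSpace hΩ hp)] with t ht
  refine ht ?_
  simp [Finset.sum_add_distrib, hp.2.1, ← Finset.mul_sum, show ∑ m, w.1 m = 0 from hw]

/-- A differential within the parameter space is determined on tangent vectors. -/
theorem hasFDerivWithinAt_paramSpace_unique (hΩ : IsOpen Ω) {p : Params M d}
    (hp : p ∈ paramSpace M Ω amin Dmin) {F : Params M d → ℝ} {L L' : Params M d →L[ℝ] ℝ}
    (hL : HasFDerivWithinAt F L (paramSpace M Ω amin Dmin) p)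
    (hL' : HasFDerivWithinAt F L' (paramSpace M Ω amin Dmin) p) {w : Params M d}
    (hw : w ∈ tangent M d) : L w = L' w := by
  have hline : HasDerivAt (fun t : ℝ => p + t • w) w 0 := by
    simpa using ((hasDerivAt_id (0 : ℝ)).smul_const w).const_add p
  have h : ∀ L : Params M d →L[ℝ] ℝ, HasFDerivWithinAt F L (paramSpace M Ω amin Dmin) p →
      HasDerivAt (F ∘ fun t : ℝ => p + t • w) (L w) 0 := fun L hL =>
    HasFDerivWithinAt.comp_hasDerivAt_of_eq 0 hL hline (eventually_line_mem_paramSpace hΩ hp hw)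
      (by simp)
  exact (h L hL).unique (h L' hL')

/-- The covector with weight components `h` and location components `k`, the latter relative to
the weights of `p`. -/
noncomputable def covector (p : Params M d) (h : Fin M → ℝ)
    (k : Fin M → EuclideanSpace ℝ (Fin d)) (w : Params M d) : ℝ :=
  ∑ m, h m * w.1 m + ∑ m, p.1 m * inner ℝ (k m) (w.2 m)

/-- Two Schrödinger equations with the same weights cannot be strictly ordered term by term; this
bounds the increments of a potential by increments of the cost. -/
theorem exists_le_of_sum_mul_exp_eq {κ : Type*} [Fintype κ] {b : κ → ℝ} (hb : ∀ n, 0 < b n)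
    {F F' : κ → ℝ} (hF : ∑ n, b n * Real.exp (F n) = 1) (hF' : ∑ n, b n * Real.exp (F' n) = 1) :
    ∃ n, F n ≤ F' n := by
  by_contra! h
  have hne : (Finset.univ : Finset κ).Nonempty := by
    rw [Finset.nonempty_iff_ne_empty]
    rintro h0
    simp [h0] at hF
  have := Finset.sum_lt_sum_of_nonempty hne fun n _ =>
    mul_lt_mul_of_pos_left (Real.exp_lt_exp.2 (h n)) (hb n)
  linarith

theorem norm_sub_sum_smul_le {V κ : Type*} [NormedAddCommGroup V] [NormedSpace ℝ V] [Fintype κ]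
    {w : κ → ℝ} (hw : ∀ k, 0 ≤ w k) (hw1 : ∑ k, w k = 1) {c : V} {e : κ → V} {D : ℝ}
    (h : ∀ k, ‖c - e k‖ ≤ D) : ‖c - ∑ k, w k • e k‖ ≤ D := by
  have h1 : c - ∑ k, w k • e k = ∑ k, w k • (c - e k) := by
    simp only [smul_sub, Finset.sum_sub_distrib, ← Finset.sum_smul, hw1, one_smul]
  rw [h1]
  calc _ ≤ ∑ k, ‖w k • (c - e k)‖ := norm_sum_le _ _
    _ ≤ ∑ k, w k * D := Finset.sum_le_sum fun k _ => by
        rw [norm_smul, Real.norm_of_nonneg (hw k)]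
        exact mul_le_mul_of_nonneg_left (h k) (hw k)
    _ = D := by rw [← Finset.sum_mul, hw1, one_mul]

/-- Mixed second differences of the quadratic cost are bounded by `D ^ 2`. -/
theorem quadratic_cost_mixed_difference_le {V : Type*} [NormedAddCommGroup V]
    [InnerProductSpace ℝ V] {x x' y z : V} {D : ℝ} (h1 : ‖x - x'‖ ≤ D) (h2 : ‖y - z‖ ≤ D) :
    (‖x - y‖ ^ 2 / 2 - ‖x' - y‖ ^ 2 / 2) - (‖x - z‖ ^ 2 / 2 - ‖x' - z‖ ^ 2 / 2) ≤ D ^ 2 := by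
  have h : (‖x - y‖ ^ 2 / 2 - ‖x' - y‖ ^ 2 / 2) - (‖x - z‖ ^ 2 / 2 - ‖x' - z‖ ^ 2 / 2) =
      -inner ℝ (x - x') (y - z) := by
    simp only [norm_sub_sq_real, inner_sub_left, inner_sub_right]
    ring
  rw [h]
  have h3 := neg_le_of_abs_le (abs_real_inner_le_norm (x - x') (y - z))
  have h4 := mul_le_mul h1 h2 (norm_nonneg _) ((norm_nonneg _).trans h1)
  nlinarith

theorem hasFDerivWithinAt_partial_left (hamin : 0 < amin) (hDmin : 0 < Dmin)
    {F : Params M d × Params M d → ℝ} {L : Params M d × Params M d →L[ℝ] ℝ} {p q : Params M d}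
    (hq : IsProper q) (hL : HasFDerivWithinAt F L {z | IsProper z.1 ∧ IsProper z.2} (p, q)) :
    HasFDerivWithinAt (fun p' => F (p', q)) (L.comp (ContinuousLinearMap.inl ℝ _ _))
      (paramSpace M Ω amin Dmin) p :=
  HasFDerivWithinAt.comp (f := fun p' : Params M d => (p', q)) p hL
    (hasFDerivAt_prodMk_left (𝕜 := ℝ) p q).hasFDerivWithinAt
    fun _ hp' => ⟨isProper_of_mem_paramSpace hamin hDmin hp', hq⟩

theorem hasFDerivWithinAt_sinkhorn (hamin : 0 < amin) (hDmin : 0 < Dmin) {ε : ℝ} (hε : 0 < ε)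
    {p q : Params M d} (hp : p ∈ paramSpace M Ω amin Dmin) (hq : q ∈ paramSpace M Ω amin Dmin)
    {u v u' v' : Fin M → ℝ} (h : IsPotential ε p q u v) (h' : IsPotential ε p p u' v') :
    ∃ L : Params M d →L[ℝ] ℝ,
      HasFDerivWithinAt (fun p' => sinkhorn ε (toMeasure p') (toMeasure q)) L
        (paramSpace M Ω amin Dmin) p ∧
      ∀ w, L w = otDifferential ε u v p q w 0 - otDifferential ε u' v' p p w w / 2 := by
  have hp' := isProper_of_mem_paramSpace hamin hDmin hp
  have hq' := isProper_of_mem_paramSpace hamin hDmin hq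
  obtain ⟨L₁, hL₁, hL₁w⟩ := exists_hasFDerivWithinAt_entropicOT hε hp' hq' h
  obtain ⟨L₂, hL₂, hL₂w⟩ := exists_hasFDerivWithinAt_entropicOT hε hp' hp' h'
  have h1 := hasFDerivWithinAt_partial_left (Ω := Ω) hamin hDmin hq' hL₁
  have hdiag := (hasFDerivAt_id (𝕜 := ℝ) p).prodMk (hasFDerivAt_id (𝕜 := ℝ) p)
  have h2 := HasFDerivWithinAt.comp (f := fun p' : Params M d => (p', p')) p hL₂
    hdiag.hasFDerivWithinAt (s := paramSpace M Ω amin Dmin) fun p' hp' =>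
      ⟨isProper_of_mem_paramSpace hamin hDmin hp', isProper_of_mem_paramSpace hamin hDmin hp'⟩
  have h3 := (h1.sub (h2.mul_const (2 : ℝ)⁻¹)).sub_const
    (entropicOT ε (toMeasure q) (toMeasure q) / 2)
  refine ⟨_, h3, fun w => ?_⟩
  simp only [_root_.sub_apply, _root_.smul_apply, ContinuousLinearMap.comp_apply, hL₁w, hL₂w,
    ContinuousLinearMap.inl_apply, ContinuousLinearMap.prod_apply, ContinuousLinearMap.id_apply,
    smul_eq_mul]
  ring

/-- The differential of the Sinkhorn divergence is a covector with weight components of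
oscillation at most `D ^ 2` and location components of norm at most `D`. -/
theorem exists_hasFDerivWithinAt_sinkhorn (hΩ : Bornology.IsBounded Ω) (hamin : 0 < amin)
    (hDmin : 0 < Dmin) {ε : ℝ} (hε : 0 < ε) {p q : Params M d}
    (hp : p ∈ paramSpace M Ω amin Dmin) (hq : q ∈ paramSpace M Ω amin Dmin) :
    ∃ (L : Params M d →L[ℝ] ℝ) (h : Fin M → ℝ) (k : Fin M → EuclideanSpace ℝ (Fin d)),
      HasFDerivWithinAt (fun p' => sinkhorn ε (toMeasure p') (toMeasure q)) L
        (paramSpace M Ω amin Dmin) p ∧ (∀ w, L w = covector p h k w) ∧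
      (∀ m m', h m - h m' ≤ Metric.diam Ω ^ 2) ∧ ∀ m, ‖k m‖ ≤ Metric.diam Ω := by
  have hp' := isProper_of_mem_paramSpace hamin hDmin hp
  have hq' := isProper_of_mem_paramSpace hamin hDmin hq
  obtain ⟨u, v, huv⟩ := exists_isPotential hp' hq' ε
  obtain ⟨u', v', huv'⟩ := exists_isPotential hp' hp' ε
  obtain ⟨L, hL, hLw⟩ := hasFDerivWithinAt_sinkhorn hamin hDmin hε hp hq huv huv'
  have ht := huv.isCouplingDensity
  have ht' := huv'.isCouplingDensity
  have hD : ∀ {x y}, x ∈ Ω → y ∈ Ω → ‖x - y‖ ≤ Metric.diam Ω := fun hx hy => by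
    rw [← dist_eq_norm]
    exact Metric.dist_le_diam_of_mem hΩ hx hy
  refine ⟨L, fun m => ε * (u m - (u' m + v' m) / 2),
    fun m => ∑ n, (q.1 n * gibbs ε u v p q m n) • (p.2 m - q.2 n) -
      ∑ n, (p.1 n * ((gibbs ε u' v' p p m n + gibbs ε u' v' p p n m) / 2)) • (p.2 m - p.2 n),
    hL, fun w => ?_, fun m m' => ?_, fun m => ?_⟩
  · rw [hLw, otDifferential, otDifferential, covector]
    have e1 : ∀ m, p.1 m * inner ℝ (∑ n, (q.1 n * gibbs ε u v p q m n) • (p.2 m - q.2 n) -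
        ∑ n, (p.1 n * ((gibbs ε u' v' p p m n + gibbs ε u' v' p p n m) / 2)) •
          (p.2 m - p.2 n)) (w.2 m) =
        ∑ n, p.1 m * q.1 n * gibbs ε u v p q m n * inner ℝ (p.2 m - q.2 n) (w.2 m) -
        (∑ n, p.1 m * p.1 n * gibbs ε u' v' p p m n * inner ℝ (p.2 m - p.2 n) (w.2 m) +
          ∑ n, p.1 m * p.1 n * gibbs ε u' v' p p n m * inner ℝ (p.2 m - p.2 n) (w.2 m)) / 2 := by
      intro m
      simp only [_root_.inner_sub_left (∑ n, _), sum_inner, real_inner_smul_left, mul_sub,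
        Finset.mul_sum, ← Finset.sum_add_distrib, Finset.sum_div]
      congr 1
      · exact Finset.sum_congr rfl fun n _ => by ring
      · exact Finset.sum_congr rfl fun n _ => by ring
    have e2 : ∑ m, ∑ n, p.1 m * p.1 n * gibbs ε u' v' p p m n *
          inner ℝ (p.2 m - p.2 n) (w.2 m - w.2 n) =
        ∑ m, ∑ n, p.1 m * p.1 n * gibbs ε u' v' p p m n * inner ℝ (p.2 m - p.2 n) (w.2 m) +
        ∑ m, ∑ n, p.1 m * p.1 n * gibbs ε u' v' p p n m * inner ℝ (p.2 m - p.2 n) (w.2 m) := by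
      simp only [_root_.inner_sub_right _ (w.2 _), mul_sub, Finset.sum_sub_distrib]
      rw [sub_eq_add_neg]
      congr 1
      rw [Finset.sum_comm, ← Finset.sum_neg_distrib]
      refine Finset.sum_congr rfl fun m _ => ?_
      rw [← Finset.sum_neg_distrib]
      refine Finset.sum_congr rfl fun n _ => ?_
      rw [← neg_sub (p.2 m) (p.2 n), inner_neg_left]
      ring
    have e3 : ∑ m, ε * (u m - (u' m + v' m) / 2) * w.1 m =
        ε * ∑ m, w.1 m * u m - (ε * ∑ m, w.1 m * u' m + ε * ∑ m, w.1 m * v' m) / 2 := by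
      simp only [Finset.mul_sum, ← Finset.sum_add_distrib, Finset.sum_div,
        ← Finset.sum_sub_distrib]
      exact Finset.sum_congr rfl fun n _ => by ring
    simp only [e1, e2, e3, Prod.fst_zero, Prod.snd_zero, Pi.zero_apply, zero_mul,
      Finset.sum_const_zero, sub_zero, Finset.sum_sub_distrib, ← Finset.sum_div,
      Finset.sum_add_distrib]
    ring
  · obtain ⟨n, hn⟩ := exists_le_of_sum_mul_exp_eq hq'.pos (huv.1 m) (huv.1 m')
    obtain ⟨k, hk⟩ := exists_le_of_sum_mul_exp_eq hp'.pos (huv'.1 m') (huv'.1 m)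
    obtain ⟨l, hl⟩ := exists_le_of_sum_mul_exp_eq hp'.pos (huv'.2 m') (huv'.2 m)
    have h1 := quadratic_cost_mixed_difference_le (hD (hp.2.2.1 m) (hp.2.2.1 m'))
      (hD (hq.2.2.1 n) (hp.2.2.1 k))
    have h2 := quadratic_cost_mixed_difference_le (hD (hp.2.2.1 m) (hp.2.2.1 m'))
      (hD (hq.2.2.1 n) (hp.2.2.1 l))
    have e : ∀ p q : Params M d, ∀ m n, atomCost p q m n = ε * (atomCost p q m n / ε) :=
      fun p q m n => (mul_div_cancel₀ _ hε.ne').symm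
    have hn' : ε * (u m - u m') ≤ atomCost p q m n - atomCost p q m' n := by
      rw [e p q m, e p q m', ← mul_sub]
      exact mul_le_mul_of_nonneg_left (by linarith) hε.le
    have hk' : atomCost p p m k - atomCost p p m' k ≤ ε * (u' m - u' m') := by
      rw [e p p m, e p p m', ← mul_sub]
      exact mul_le_mul_of_nonneg_left (by linarith) hε.le
    have hl' : atomCost p p l m - atomCost p p l m' ≤ ε * (v' m - v' m') := by
      rw [e p p l m, e p p l m', ← mul_sub]
      exact mul_le_mul_of_nonneg_left (by linarith) hε.le
    simp only [atomCost] at hn' hk' hl'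
    rw [norm_sub_rev (p.2 l) (p.2 m), norm_sub_rev (p.2 l) (p.2 m')] at hl'
    linarith
  · rw [norm_sub_rev]
    have hG : ∀ p q u v m n, 0 ≤ gibbs (d := d) (M := M) ε u v p q m n :=
      fun _ _ _ _ _ _ => (Real.exp_pos _).le
    refine norm_sub_sum_smul_le (fun n => mul_nonneg (hq'.pos n).le (hG _ _ _ _ _ _)) (ht.2.1 m)
      fun n => ?_
    rw [norm_sub_rev]
    refine norm_sub_sum_smul_le (fun k => mul_nonneg (hp'.pos k).le
      (div_nonneg (add_nonneg (hG _ _ _ _ _ _) (hG _ _ _ _ _ _)) two_pos.le)) ?_ fun k => ?_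
    · simp only [mul_div_assoc', mul_add, ← Finset.sum_div, Finset.sum_add_distrib, ht'.2.1 m,
        ht'.2.2 m]
      norm_num
    · rw [sub_sub_sub_cancel_left]
      exact hD (hp.2.2.1 k) (hq.2.2.1 n)

/-- The differential of `S_ε(·, X)` vanishes at `X`: since `OT_ε` is symmetric, its two partial
differentials on the diagonal agree. -/
theorem hasFDerivWithinAt_sinkhorn_self (hΩ : IsOpen Ω) (hamin : 0 < amin)
    (hDmin : 0 < Dmin) {ε : ℝ} (hε : 0 < ε) {p : Params M d}
    (hp : p ∈ paramSpace M Ω amin Dmin) :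
    ∃ L : Params M d →L[ℝ] ℝ,
      HasFDerivWithinAt (fun p' => sinkhorn ε (toMeasure p') (toMeasure p)) L
        (paramSpace M Ω amin Dmin) p ∧ ∀ w ∈ tangent M d, L w = 0 := by
  have hp' := isProper_of_mem_paramSpace hamin hDmin hp
  obtain ⟨u, v, huv⟩ := exists_isPotential hp' hp' ε
  obtain ⟨L, hL, hLw⟩ := hasFDerivWithinAt_sinkhorn hamin hDmin hε hp hp huv huv
  refine ⟨L, hL, fun w hw => ?_⟩
  obtain ⟨L₁, hL₁, hL₁w⟩ := exists_hasFDerivWithinAt_entropicOT hε hp' hp' huv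
  have h1 := hasFDerivWithinAt_partial_left (Ω := Ω) hamin hDmin hp' hL₁
  have h2 := HasFDerivWithinAt.comp (f := fun p' : Params M d => (p, p')) p hL₁
    (hasFDerivAt_prodMk_right (𝕜 := ℝ) p p).hasFDerivWithinAt (s := paramSpace M Ω amin Dmin)
    fun p' hp'' => ⟨hp', isProper_of_mem_paramSpace hamin hDmin hp''⟩
  have h3 := h2.congr (fun p' hp'' =>
    entropicOT_comm (isProper_of_mem_paramSpace hamin hDmin hp'') hp' hε) rfl
  have h4 := hasFDerivWithinAt_paramSpace_unique hΩ hp h1 h3 hw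
  simp only [ContinuousLinearMap.comp_apply, ContinuousLinearMap.inl_apply,
    ContinuousLinearMap.inr_apply] at h4
  have h5 : L₁ (w, w) = L₁ (w, 0) + L₁ (0, w) := by rw [← map_add]; simp
  have h6 := hL₁w (w, w)
  have h7 := hL₁w (w, 0)
  rw [hLw, ← h6, ← h7, h5, ← h4]
  ring

end SinkhornDerivative

end SinkhornSHK

/-! ### Energy, SHK gradient and retraction -/

namespace SinkhornSHK

section Energy

variable {d M N : ℕ} {Ω : Set (EuclideanSpace ℝ (Fin d))} {amin Dmin : ℝ}

theorem sinkhorn_self (ε : ℝ) (μ : Measure (EuclideanSpace ℝ (Fin d))) : sinkhorn ε μ μ = 0 := by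
  rw [sinkhorn]; ring

theorem mem_basin_self {ε r : ℝ} (hr : 0 ≤ r) {p : Params M d}
    (hp : p ∈ paramSpace M Ω amin Dmin) :
    toMeasure p ∈ basin M Ω amin Dmin ε (toMeasure p) r :=
  ⟨⟨p, hp, rfl⟩, (sinkhorn_self ε _).trans_le hr⟩

/-- Under margin separation the competing Gibbs weights sum to at most `(N - 1) e^{-βΔ}`,
relative to the weight of the pattern `i`. -/
theorem sum_exp_erase_le {s : Fin N → ℝ} {i : Fin N} {β Δ : ℝ} (hβ : 0 < β)
    (hs : ∀ j, j ≠ i → Δ ≤ s j - s i) :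
    ∑ j ∈ Finset.univ.erase i, Real.exp (-β * s j) ≤
      Real.exp (-β * s i) * (((N : ℝ) - 1) * Real.exp (-β * Δ)) := by
  have hN : 1 ≤ N := i.pos
  calc _ ≤ ∑ _j ∈ Finset.univ.erase i, Real.exp (-β * s i) * Real.exp (-β * Δ) := by
        refine Finset.sum_le_sum fun j hj => ?_
        rw [← Real.exp_add, Real.exp_le_exp]
        have := mul_le_mul_of_nonneg_left (hs j (Finset.ne_of_mem_erase hj)) hβ.le
        linarith
    _ = _ := by
        rw [Finset.sum_const, Finset.card_erase_of_mem (Finset.mem_univ i), Finset.card_univ,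
          Fintype.card_fin, nsmul_eq_mul, Nat.cast_sub hN, Nat.cast_one]
        ring

/-- Compare the minimizer with `X i`, whose energy is at most zero. -/
theorem sinkhorn_le_of_isBasinMinimizer {ε β r Δ : ℝ} (hβ : 0 < β) (hr : 0 ≤ r)
    {p : Fin N → Params M d} (hp : ∀ j, p j ∈ paramSpace M Ω amin Dmin)
    {X : Fin N → Measure (EuclideanSpace ℝ (Fin d))} (hX : ∀ j, X j = toMeasure (p j)) {i : Fin N}
    (hsep : MarginSeparation M Ω amin Dmin ε X i r Δ)
    {ξ : Measure (EuclideanSpace ℝ (Fin d))}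
    (hξ : IsBasinMinimizer M Ω amin Dmin ε β X i r ξ) :
    sinkhorn ε ξ (X i) ≤ 1 / β * Real.log (1 + ((N : ℝ) - 1) * Real.exp (-β * Δ)) := by
  have hXi : X i ∈ basin M Ω amin Dmin ε (X i) r := by
    rw [hX i]; exact mem_basin_self hr (hp i)
  have hN : (1 : ℝ) ≤ N := by exact_mod_cast i.pos
  have hK : 0 ≤ ((N : ℝ) - 1) * Real.exp (-β * Δ) :=
    mul_nonneg (sub_nonneg.2 hN) (Real.exp_pos _).le
  have hmin := hξ.2 _ hXi
  have h1 : 1 ≤ ∑ j, Real.exp (-β * sinkhorn ε (X i) (X j)) := by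
    have := Finset.single_le_sum (f := fun j => Real.exp (-β * sinkhorn ε (X i) (X j)))
      (fun j _ => (Real.exp_pos _).le) (Finset.mem_univ i)
    simpa [sinkhorn_self] using this
  have h2 : ∑ j, Real.exp (-β * sinkhorn ε ξ (X j)) ≤
      Real.exp (-β * sinkhorn ε ξ (X i)) * (1 + ((N : ℝ) - 1) * Real.exp (-β * Δ)) := by
    rw [← Finset.add_sum_erase _ _ (Finset.mem_univ i), mul_add, mul_one]
    have := sum_exp_erase_le (s := fun j => sinkhorn ε ξ (X j)) hβ (hsep ξ hξ.1)
    gcongr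
  have h3 : 0 < ∑ j, Real.exp (-β * sinkhorn ε ξ (X j)) :=
    Finset.sum_pos (fun _ _ => Real.exp_pos _) ⟨i, Finset.mem_univ i⟩
  have h4 := Real.log_le_log h3 h2
  rw [Real.log_mul (Real.exp_pos _).ne' (by positivity), Real.log_exp] at h4
  have h5 := Real.log_nonneg h1
  have h6 : 0 ≤ 1 / β := by positivity
  unfold energy at hmin
  have h7 : 0 ≤ 1 / β * Real.log (∑ j, Real.exp (-β * sinkhorn ε ξ (X j))) := by
    have := mul_nonneg h6 h5
    linarith
  have h8 := mul_le_mul_of_nonneg_left h4 h6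
  have h9 : 1 / β * (-β * sinkhorn ε ξ (X i) +
      Real.log (1 + ((N : ℝ) - 1) * Real.exp (-β * Δ))) = -sinkhorn ε ξ (X i) +
      1 / β * Real.log (1 + ((N : ℝ) - 1) * Real.exp (-β * Δ)) := by
    field_simp
  linarith

/-- The differential of the energy at the stored pattern `i` is a covector whose size is controlled
by the softmax weight of the other patterns: the term of the pattern itself vanishes. -/
theorem exists_hasFDerivWithinAt_energy (hΩo : IsOpen Ω) (hΩ : Bornology.IsBounded Ω)
    (hamin : 0 < amin) (hDmin : 0 < Dmin) {ε β r Δ : ℝ} (hε : 0 < ε) (hβ : 0 < β) (hr : 0 ≤ r)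
    {p : Fin N → Params M d} (hp : ∀ j, p j ∈ paramSpace M Ω amin Dmin)
    {X : Fin N → Measure (EuclideanSpace ℝ (Fin d))} (hX : ∀ j, X j = toMeasure (p j)) {i : Fin N}
    (hsep : MarginSeparation M Ω amin Dmin ε X i r Δ) {W : ℝ}
    (hW : W = ((N : ℝ) - 1) * Real.exp (-β * Δ) / (1 + ((N : ℝ) - 1) * Real.exp (-β * Δ))) :
    ∃ (L : Params M d →L[ℝ] ℝ) (h : Fin M → ℝ) (k : Fin M → EuclideanSpace ℝ (Fin d)),
      HasFDerivWithinAt (fun q => energy ε β X (toMeasure q)) L (paramSpace M Ω amin Dmin) (p i) ∧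
      (∀ w ∈ tangent M d, L w = covector (p i) h k w) ∧
      (∀ m m', h m - h m' ≤ W * Metric.diam Ω ^ 2) ∧ ∀ m, ‖k m‖ ≤ W * Metric.diam Ω := by
  have hN : (1 : ℝ) ≤ N := by exact_mod_cast i.pos
  have key : ∀ j, ∃ (L : Params M d →L[ℝ] ℝ) (h : Fin M → ℝ)
      (k : Fin M → EuclideanSpace ℝ (Fin d)),
      HasFDerivWithinAt (fun q => sinkhorn ε (toMeasure q) (X j)) L
        (paramSpace M Ω amin Dmin) (p i) ∧
      (∀ w ∈ tangent M d, L w = covector (p i) h k w) ∧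
      (∀ m m', h m - h m' ≤ (if j = i then 0 else 1) * Metric.diam Ω ^ 2) ∧
      ∀ m, ‖k m‖ ≤ (if j = i then 0 else 1) * Metric.diam Ω := by
    intro j
    by_cases hj : j = i
    · subst hj
      obtain ⟨L, hL, hL0⟩ := hasFDerivWithinAt_sinkhorn_self hΩo hamin hDmin hε (hp j)
      refine ⟨L, 0, 0, by rwa [hX j], fun w hw => ?_, by simp, by simp⟩
      simp [hL0 w hw, covector]
    · obtain ⟨L, h, k, hL, hLw, hh, hk⟩ :=
        exists_hasFDerivWithinAt_sinkhorn hΩ hamin hDmin hε (hp i) (hp j)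
      exact ⟨L, h, k, by rwa [hX j], fun w _ => hLw w, by simpa [hj] using hh,
        by simpa [hj] using hk⟩
  choose L h k hL hLw hh hk using key
  set s : Fin N → ℝ := fun j => sinkhorn ε (X i) (X j) with hs
  set Z : ℝ := ∑ j, Real.exp (-β * s j) with hZ
  set Q : ℝ := ∑ j ∈ Finset.univ.erase i, Real.exp (-β * s j) with hQ
  set σ : Fin N → ℝ := fun j => Real.exp (-β * s j) / Z with hσ
  have hsi : s i = 0 := sinkhorn_self ε _
  have hZQ : Z = 1 + Q := by
    rw [hZ, ← Finset.add_sum_erase _ _ (Finset.mem_univ i)]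
    rw [hsi, mul_zero, Real.exp_zero]
  have hQ0 : 0 ≤ Q := Finset.sum_nonneg fun _ _ => (Real.exp_pos _).le
  have hZpos : 0 < Z := by linarith
  have hσ0 : ∀ j, 0 ≤ σ j := fun j => div_nonneg (Real.exp_pos _).le hZpos.le
  have hQK : Q ≤ ((N : ℝ) - 1) * Real.exp (-β * Δ) := by
    have hXi : X i ∈ basin M Ω amin Dmin ε (X i) r := by
      rw [hX i]; exact mem_basin_self hr (hp i)
    have := sum_exp_erase_le (s := s) hβ (hsep _ hXi)
    rwa [hsi, mul_zero, Real.exp_zero, one_mul] at this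
  have hσW : ∑ j, σ j * (if j = i then 0 else 1) ≤ W := by
    rw [← Finset.add_sum_erase _ _ (Finset.mem_univ i)]
    have e : ∑ j ∈ Finset.univ.erase i, σ j * (if j = i then 0 else 1) = Q / Z := by
      rw [hQ, Finset.sum_div]
      refine Finset.sum_congr rfl fun j hj => ?_
      rw [if_neg (Finset.ne_of_mem_erase hj), mul_one]
    rw [e, if_pos rfl, mul_zero, zero_add, hW, hZQ,
      div_le_div_iff₀ (by linarith) (by linarith)]
    linarith
  have hD : 0 ≤ Metric.diam Ω := Metric.diam_nonneg
  refine ⟨∑ j, σ j • L j, fun m => ∑ j, σ j * h j m, fun m => ∑ j, σ j • k j m, ?_,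
    fun w hw => ?_, fun m m' => ?_, fun m => ?_⟩
  · have h1 := HasFDerivWithinAt.fun_sum (u := Finset.univ) fun j _ =>
      ((hL j).const_mul (-β)).exp
    have hne : ∑ j, Real.exp (-β * sinkhorn ε (toMeasure (p i)) (X j)) ≠ 0 := by
      rw [← hX i]; exact hZpos.ne'
    have h2 := (h1.log hne).const_mul (-(1 / β))
    refine h2.congr_fderiv ?_
    rw [← hX i, Finset.smul_sum, Finset.smul_sum]
    refine Finset.sum_congr rfl fun j _ => ?_
    simp only [smul_smul]
    congr 1
    simp only [hσ, hZ, hs]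
    field_simp
  · have e1 : (∑ j, σ j • L j) w = ∑ j, σ j * covector (p i) (h j) (k j) w := by
      simp only [_root_.sum_apply, _root_.smul_apply, hLw _ w hw,
        smul_eq_mul]
    rw [e1]
    simp only [covector, mul_add, Finset.sum_add_distrib, Finset.mul_sum, Finset.sum_mul,
      sum_inner, real_inner_smul_left]
    rw [Finset.sum_comm]
    congr 1
    · simp only [mul_assoc]
    · rw [Finset.sum_comm]
      exact Finset.sum_congr rfl fun m _ => Finset.sum_congr rfl fun j _ => by ring
  · calc _ = ∑ j, σ j * (h j m - h j m') := by simp only [mul_sub, Finset.sum_sub_distrib]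
      _ ≤ ∑ j, σ j * ((if j = i then 0 else 1) * Metric.diam Ω ^ 2) :=
        Finset.sum_le_sum fun j _ => mul_le_mul_of_nonneg_left (hh j m m') (hσ0 j)
      _ ≤ _ := by
        simp only [← mul_assoc, ← Finset.sum_mul]
        exact mul_le_mul_of_nonneg_right hσW (sq_nonneg _)
  · calc _ ≤ ∑ j, ‖σ j • k j m‖ := norm_sum_le _ _
      _ ≤ ∑ j, σ j * ((if j = i then 0 else 1) * Metric.diam Ω) :=
        Finset.sum_le_sum fun j _ => by
          rw [norm_smul, Real.norm_of_nonneg (hσ0 j)]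
          exact mul_le_mul_of_nonneg_left (hk j m) (hσ0 j)
      _ ≤ _ := by
        simp only [← mul_assoc, ← Finset.sum_mul]
        exact mul_le_mul_of_nonneg_right hσW hD

/-- The Riesz vector of a covector for the SHK metric, on tangent vectors. -/
noncomputable def rieszVector (lam : ℝ) (p : Params M d) (h : Fin M → ℝ)
    (k : Fin M → EuclideanSpace ℝ (Fin d)) : Params M d :=
  (fun m => p.1 m * ((h m - ∑ j, p.1 j * h j) / lam ^ 2), k)

theorem rieszVector_mem_tangent (lam : ℝ) {p : Params M d} (hp : IsProper p) (h : Fin M → ℝ)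
    (k : Fin M → EuclideanSpace ℝ (Fin d)) : rieszVector lam p h k ∈ tangent M d := by
  simp only [tangent, rieszVector, Set.mem_ofPred_eq, mul_div_assoc', ← Finset.sum_div, mul_sub,
    Finset.sum_sub_distrib, ← Finset.sum_mul, hp.sum_eq]
  simp

theorem shkInner_rieszVector {lam : ℝ} (hlam : 0 < lam) {p : Params M d} (hp : IsProper p)
    (h : Fin M → ℝ) (k : Fin M → EuclideanSpace ℝ (Fin d)) {w : Params M d}
    (hw : w ∈ tangent M d) : shkInner lam p (rieszVector lam p h k) w = covector p h k w := by
  have e : ∀ m, lam ^ 2 / p.1 m * (p.1 m * ((h m - ∑ j, p.1 j * h j) / lam ^ 2)) * w.1 m =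
      h m * w.1 m - (∑ j, p.1 j * h j) * w.1 m := fun m => by
    have := (hp.pos m).ne'
    field_simp
  simp only [shkInner, rieszVector, e, Finset.sum_add_distrib, Finset.sum_sub_distrib,
    ← Finset.mul_sum, show ∑ m, w.1 m = 0 from hw, covector]
  ring

theorem eq_of_shkInner_eq {lam : ℝ} (hlam : 0 < lam) {p : Params M d} (hp : IsProper p)
    {g g' : Params M d} (hg : g ∈ tangent M d) (hg' : g' ∈ tangent M d)
    (h : ∀ w ∈ tangent M d, shkInner lam p g w = shkInner lam p g' w) : g = g' := by
  have ht : g - g' ∈ tangent M d := by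
    simp [tangent, show ∑ m, g.1 m = 0 from hg, show ∑ m, g'.1 m = 0 from hg']
  have h1 : ∑ m, (lam ^ 2 / p.1 m * (g.1 m - g'.1 m) ^ 2 +
      p.1 m * ‖g.2 m - g'.2 m‖ ^ 2) = 0 := by
    rw [← sub_eq_zero.2 (h _ ht), shkInner, shkInner, ← Finset.sum_sub_distrib]
    refine Finset.sum_congr rfl fun m _ => ?_
    rw [← real_inner_self_eq_norm_sq]
    simp only [Prod.fst_sub, Prod.snd_sub, Pi.sub_apply, inner_sub_left]
    ring
  have h2 := (Finset.sum_eq_zero_iff_of_nonneg fun m _ => by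
    have := hp.pos m
    positivity).1 h1
  have h3 : ∀ m, g.1 m = g'.1 m ∧ g.2 m = g'.2 m := fun m => by
    have h4 := h2 m (Finset.mem_univ m)
    have hpm := hp.pos m
    rw [add_eq_zero_iff_of_nonneg (by positivity) (by positivity)] at h4
    refine ⟨?_, ?_⟩
    · have := h4.1
      have hne : lam ^ 2 / p.1 m ≠ 0 := by positivity
      simpa [hne, sub_eq_zero, hlam.ne', hpm.ne'] using this
    · have := h4.2
      simpa [hpm.ne', sub_eq_zero] using this
  exact Prod.ext (funext fun m => (h3 m).1) (funext fun m => (h3 m).2)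

theorem isSHKGradient_unique (hΩ : IsOpen Ω) (hamin : 0 < amin) (hDmin : 0 < Dmin) {lam : ℝ}
    (hlam : 0 < lam) {F : Measure (EuclideanSpace ℝ (Fin d)) → ℝ} {p g g' : Params M d}
    (hp : p ∈ paramSpace M Ω amin Dmin) (hg : IsSHKGradient Ω amin Dmin lam F p g)
    (hg' : IsSHKGradient Ω amin Dmin lam F p g') : g = g' := by
  obtain ⟨ht, L, hL, hLg⟩ := hg
  obtain ⟨ht', L', hL', hLg'⟩ := hg'
  refine eq_of_shkInner_eq hlam (isProper_of_mem_paramSpace hamin hDmin hp) ht ht' fun w hw => ?_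
  rw [hLg w hw, hLg' w hw, hasFDerivWithinAt_paramSpace_unique hΩ hp hL hL' hw]

end Energy

section Retraction

variable {d M : ℕ} {Ω : Set (EuclideanSpace ℝ (Fin d))} {amin Dmin : ℝ}

theorem mem_of_dist_lt_infDist_frontier {V : Type*} [NormedAddCommGroup V] [NormedSpace ℝ V]
    {Ω : Set V} (hΩ : IsOpen Ω) {x y : V} (hx : x ∈ Ω) (h : dist y x < Metric.infDist x (frontier Ω)) :
    y ∈ Ω := by
  have hpos : 0 < Metric.infDist x (frontier Ω) := dist_nonneg.trans_lt h
  have hsub : closure Ω ∩ Metric.ball x (Metric.infDist x (frontier Ω)) ⊆ Ω := fun z hz => by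
    by_contra hzΩ
    have hzf : z ∈ frontier Ω := hΩ.frontier_eq ▸ ⟨hz.1, hzΩ⟩
    have h1 := Metric.infDist_le_dist_of_mem (x := x) hzf
    have h2 := hz.2
    rw [Metric.mem_ball, dist_comm] at h2
    linarith
  exact (convex_ball x (Metric.infDist x (frontier Ω))).isPreconnected.subset_of_closure_inter_subset
    hΩ ⟨x, Metric.mem_ball_self hpos, hx⟩ hsub h

theorem retraction_zero {p : Params M d} (hp : IsProper p) : retraction p 0 = p := by
  ext m <;> simp [retraction, hp.sum_eq]

theorem sum_weight_mul_exp_pos {p : Params M d} (hp : IsProper p) (w : Fin M → ℝ) :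
    0 < ∑ m, p.1 m * Real.exp (w m) := by
  have : Nonempty (Fin M) := by
    by_contra h
    have := not_nonempty_iff.1 h
    simpa using hp.sum_eq
  exact sum_mul_exp_pos hp.pos w

theorem sum_retraction {p : Params M d} (hp : IsProper p) (v : Params M d) :
    ∑ m, (retraction p v).1 m = 1 := by
  simp only [retraction, ← Finset.sum_div]
  exact div_self (sum_weight_mul_exp_pos hp _).ne'

/-- Relative weight increments of size at most `A` change each weight by a factor at least
`e^{-2A}`: one factor `e^{-A}` from the exponential, one from the normalization. -/
theorem retraction_mem_paramSpace (hΩ : IsOpen Ω) (hamin : 0 < amin) (hDmin : 0 < Dmin) {p v : Params M d}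
    (hp : p ∈ paramSpace M Ω amin Dmin) {A B : ℝ} (hA : ∀ m, |v.1 m / p.1 m| ≤ A)
    (hB : ∀ m, ‖v.2 m‖ ≤ B) (hAa : ∀ m, amin < p.1 m * Real.exp (-(2 * A)))
    (hBΩ : ∀ m, B < Metric.infDist (p.2 m) (frontier Ω))
    (hBs : ∀ m n, m ≠ n → Dmin + 2 * B < ‖p.2 m - p.2 n‖) :
    retraction p v ∈ paramSpace M Ω amin Dmin := by
  have hp' := isProper_of_mem_paramSpace hamin hDmin hp
  refine ⟨fun m => ?_, sum_retraction hp' v, fun m => ?_, fun m n hmn => ?_⟩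
  · refine (hAa m).trans_le ?_
    simp only [retraction]
    rw [le_div_iff₀ (sum_weight_mul_exp_pos hp' _)]
    have h1 : ∑ j, p.1 j * Real.exp (v.1 j / p.1 j) ≤ Real.exp A := by
      calc _ ≤ ∑ j, p.1 j * Real.exp A := Finset.sum_le_sum fun j _ =>
            mul_le_mul_of_nonneg_left (Real.exp_le_exp.2 ((le_abs_self _).trans (hA j)))
              (hp'.pos j).le
        _ = _ := by rw [← Finset.sum_mul, hp'.sum_eq, one_mul]
    calc _ ≤ p.1 m * Real.exp (-(2 * A)) * Real.exp A :=
          mul_le_mul_of_nonneg_left h1 (mul_nonneg (hp'.pos m).le (Real.exp_pos _).le)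
      _ = p.1 m * Real.exp (-A) := by
          rw [mul_assoc, ← Real.exp_add]; congr 2; ring
      _ ≤ _ := mul_le_mul_of_nonneg_left
          (Real.exp_le_exp.2 (neg_le_of_abs_le (hA m))) (hp'.pos m).le
  · refine mem_of_dist_lt_infDist_frontier hΩ (hp.2.2.1 m) ?_
    simpa [retraction] using (hB m).trans_lt (hBΩ m)
  · have h1 := hBs m n hmn
    have h2 : p.2 m - p.2 n = (retraction p v).2 m - (retraction p v).2 n - (v.2 m - v.2 n) := by
      simp only [retraction]; abel
    have h3 := norm_sub_le ((retraction p v).2 m - (retraction p v).2 n) (v.2 m - v.2 n)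
    have h4 := norm_sub_le (v.2 m) (v.2 n)
    have h5 := hB m
    have h6 := hB n
    rw [← h2] at h3
    linarith

/-- The velocity of the curve `t ↦ Ret_p (t v)`: the weights follow a replicator equation. -/
theorem hasDerivAt_retraction {p : Params M d} (hp : IsProper p) (v : Params M d) (t : ℝ) :
    HasDerivAt (fun s : ℝ => retraction p (s • v))
      (fun m => (retraction p (t • v)).1 m * (v.1 m / p.1 m -
        ∑ j, (retraction p (t • v)).1 j * (v.1 j / p.1 j)), v.2) t := by
  refine HasDerivAt.prodMk (hasDerivAt_pi.2 fun m => ?_) (hasDerivAt_pi.2 fun m => ?_)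
  · have h1 : ∀ j, HasDerivAt (fun s : ℝ => p.1 j * Real.exp ((s • v).1 j / p.1 j))
        (p.1 j * (Real.exp ((t • v).1 j / p.1 j) * (v.1 j / p.1 j))) t := fun j => by
      have := (((hasDerivAt_id t).mul_const (v.1 j)).div_const (p.1 j)).exp.const_mul (p.1 j)
      simpa using this
    have hZ := sum_weight_mul_exp_pos hp fun j => (t • v).1 j / p.1 j
    have h2 := (h1 m).div (HasDerivAt.fun_sum fun j (_ : j ∈ Finset.univ) => h1 j) hZ.ne'
    convert! h2 using 1
    have e : ∑ j, (retraction p (t • v)).1 j * (v.1 j / p.1 j) =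
        (∑ j, p.1 j * (Real.exp ((t • v).1 j / p.1 j) * (v.1 j / p.1 j))) /
          ∑ j, p.1 j * Real.exp ((t • v).1 j / p.1 j) := by
      rw [Finset.sum_div]
      refine Finset.sum_congr rfl fun j _ => ?_
      simp only [retraction]
      ring
    rw [e]
    simp only [retraction]
    generalize ∑ j, p.1 j * (Real.exp ((t • v).1 j / p.1 j) * (v.1 j / p.1 j)) = S
    generalize v.1 m / p.1 m = z
    field_simp
  · simpa using ((hasDerivAt_id t).smul_const (v.2 m)).const_add (p.2 m)

/-- A covariance is bounded by the product of an oscillation and a supremum norm. -/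
theorem abs_covariance_le {κ : Type*} [Fintype κ] {w h z : κ → ℝ} (hw : ∀ m, 0 ≤ w m)
    (hw1 : ∑ m, w m = 1) {H C : ℝ} (hh : ∀ m m', h m - h m' ≤ H) (hz : ∀ m, |z m| ≤ C)
    (hH : 0 ≤ H) : |∑ m, h m * (w m * (z m - ∑ j, w j * z j))| ≤ H * C := by
  have e : ∑ m, h m * (w m * (z m - ∑ j, w j * z j)) =
      ∑ m, w m * ((h m - ∑ j, w j * h j) * z m) := by
    have e1 : ∀ m, h m * (w m * (z m - ∑ j, w j * z j)) =
        h m * w m * z m - (∑ j, w j * z j) * (w m * h m) := fun m => by ring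
    have e2 : ∀ m, w m * ((h m - ∑ j, w j * h j) * z m) =
        h m * w m * z m - (∑ j, w j * h j) * (w m * z m) := fun m => by ring
    simp only [e1, e2, Finset.sum_sub_distrib, ← Finset.mul_sum]
    ring
  have hosc : ∀ m, |h m - ∑ j, w j * h j| ≤ H := fun m => by
    have := norm_sub_sum_smul_le (V := ℝ) hw hw1 (c := h m) (e := h) (D := H) fun k =>
      abs_le.2 ⟨by linarith [hh k m], hh m k⟩
    simpa using this
  rw [e]
  calc _ ≤ ∑ m, |w m * ((h m - ∑ j, w j * h j) * z m)| := Finset.abs_sum_le_sum_abs _ _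
    _ ≤ ∑ m, w m * (H * C) := Finset.sum_le_sum fun m _ => by
        rw [abs_mul, abs_mul, abs_of_nonneg (hw m)]
        exact mul_le_mul_of_nonneg_left
          (mul_le_mul (hosc m) (hz m) (abs_nonneg _) hH) (hw m)
    _ = H * C := by rw [← Finset.sum_mul, hw1, one_mul]

/-- A covector is bounded on the velocities of retraction curves. -/
theorem abs_covector_le {p : Params M d} (hp : IsProper p) {h z : Fin M → ℝ}
    {k y : Fin M → EuclideanSpace ℝ (Fin d)} {H K A B : ℝ} (hH : 0 ≤ H) (hK : 0 ≤ K)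
    (hh : ∀ m m', h m - h m' ≤ H) (hk : ∀ m, ‖k m‖ ≤ K) (hz : ∀ m, |z m| ≤ A)
    (hy : ∀ m, ‖y m‖ ≤ B) :
    |covector p h k (fun m => p.1 m * (z m - ∑ j, p.1 j * z j), y)| ≤ H * A + K * B := by
  refine (abs_add_le _ _).trans (add_le_add ?_ ?_)
  · exact abs_covariance_le (fun m => (hp.pos m).le) hp.sum_eq hh hz hH
  · calc _ ≤ ∑ m, |p.1 m * inner ℝ (k m) (y m)| := Finset.abs_sum_le_sum_abs _ _
      _ ≤ ∑ m, p.1 m * (K * B) := Finset.sum_le_sum fun m _ => by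
          rw [abs_mul, abs_of_pos (hp.pos m)]
          exact mul_le_mul_of_nonneg_left ((abs_real_inner_le_norm _ _).trans
            (mul_le_mul (hk m) (hy m) (norm_nonneg _) hK)) (hp.pos m).le
      _ = K * B := by rw [← Finset.sum_mul, hp.sum_eq, one_mul]

/-- Mean value inequality for the Sinkhorn divergence along a retraction curve. -/
theorem sinkhorn_retraction_le (hΩ : Bornology.IsBounded Ω) (hamin : 0 < amin)
    (hDmin : 0 < Dmin) {ε : ℝ} (hε : 0 < ε) {p v : Params M d}
    (hp : p ∈ paramSpace M Ω amin Dmin) {A B : ℝ} (hA : ∀ m, |v.1 m / p.1 m| ≤ A)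
    (hB : ∀ m, ‖v.2 m‖ ≤ B)
    (hmem : ∀ t ∈ Set.Icc (0 : ℝ) 1, retraction p (t • v) ∈ paramSpace M Ω amin Dmin) :
    sinkhorn ε (toMeasure p) (toMeasure (retraction p v)) ≤
      Metric.diam Ω ^ 2 * A + Metric.diam Ω * B := by
  have hp' := isProper_of_mem_paramSpace hamin hDmin hp
  have hder : ∀ t ∈ Set.Icc (0 : ℝ) 1, ∃ D : ℝ, HasDerivWithinAt
      (fun s : ℝ => sinkhorn ε (toMeasure (retraction p (s • v))) (toMeasure p)) D
      (Set.Icc 0 1) t ∧ ‖D‖ ≤ Metric.diam Ω ^ 2 * A + Metric.diam Ω * B := fun t ht => by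
    obtain ⟨L, h, k, hL, hLw, hh, hk⟩ :=
      exists_hasFDerivWithinAt_sinkhorn hΩ hamin hDmin hε (hmem t ht) hp
    refine ⟨_, HasFDerivWithinAt.comp_hasDerivWithinAt (f := fun s : ℝ => retraction p (s • v)) t
      hL (hasDerivAt_retraction hp' v t).hasDerivWithinAt hmem, ?_⟩
    rw [hLw, Real.norm_eq_abs]
    exact abs_covector_le (isProper_of_mem_paramSpace hamin hDmin (hmem t ht)) (sq_nonneg _)
      Metric.diam_nonneg hh hk hA hB
  choose! D hD hDle using hder
  have h1 := (convex_Icc (0 : ℝ) 1).norm_image_sub_le_of_norm_hasDerivWithin_le hD hDle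
    (Set.left_mem_Icc.2 zero_le_one) (Set.right_mem_Icc.2 zero_le_one)
  simp only [one_smul, zero_smul, retraction_zero hp', sinkhorn_self, sub_zero, norm_one,
    mul_one] at h1
  have h2 : sinkhorn ε (toMeasure p) (toMeasure (retraction p v)) =
      sinkhorn ε (toMeasure (retraction p v)) (toMeasure p) := by
    have hm := hmem 1 (Set.right_mem_Icc.2 zero_le_one)
    rw [one_smul] at hm
    rw [sinkhorn, sinkhorn, entropicOT_comm hp' (isProper_of_mem_paramSpace hamin hDmin hm) hε]
    ring
  rw [h2]
  exact (le_abs_self _).trans h1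

end Retraction

end SinkhornSHK

/-! ### Admissible step sizes -/

namespace SinkhornSHK

section StepSize

variable {d M : ℕ} {Ω : Set (EuclideanSpace ℝ (Fin d))} {amin Dmin lam δ τ η : ℝ}
  {p : Params M d}

/-- A positive step size admitted by `etaRet` forces `Ω` to have positive diameter: otherwise the
first term of the bound is zero. -/
theorem diam_pos_of_le_etaRet (hη : 0 < η) (h : (η : EReal) ≤ etaRet Ω amin Dmin lam δ τ p) :
    0 < Metric.diam Ω := by
  refine lt_of_le_of_ne Metric.diam_nonneg fun h0 => ?_
  have h1 := EReal.coe_le_coe_iff.1 (h.trans (min_le_left _ _))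
  rw [← h0] at h1
  norm_num at h1
  linarith

theorem minWeight_le (a : Fin M → ℝ) (m : Fin M) : minWeight a ≤ a m :=
  ciInf_le (Set.finite_range a).bddBelow m

theorem boundaryDist_le (x : Fin M → EuclideanSpace ℝ (Fin d)) (m : Fin M) :
    boundaryDist Ω x ≤ Metric.infDist (x m) (frontier Ω) :=
  ciInf_le (Set.finite_range fun m => Metric.infDist (x m) (frontier Ω)).bddBelow m

theorem atomSep_le (x : Fin M → EuclideanSpace ℝ (Fin d)) {m n : Fin M} (h : m ≠ n) :
    atomSep x ≤ ((‖x m - x n‖ : ℝ) : EReal) :=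
  (iInf_le _ m).trans ((iInf_le _ n).trans (iInf_le _ h))

theorem lt_mul_exp_of_le_etaRet (hamin : 0 < amin) (hlam : 0 < lam) (hτ : 0 < τ)
    (hτ' : τ < minWeight p.1 - amin) (hη : 0 < η)
    (h : (η : EReal) ≤ etaRet Ω amin Dmin lam δ τ p) (m : Fin M) :
    amin < p.1 m * Real.exp (-(2 * (η * Metric.diam Ω ^ 2 / lam ^ 2))) := by
  have hD := diam_pos_of_le_etaRet hη h
  have h1 := EReal.coe_le_coe_iff.1 (h.trans (min_le_left _ _))
  have h2 : 2 * (η * Metric.diam Ω ^ 2 / lam ^ 2) ≤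
      Real.log ((minWeight p.1 - τ) / amin) := by
    calc _ = η * (2 * Metric.diam Ω ^ 2 / lam ^ 2) := by ring
      _ ≤ lam ^ 2 / (2 * Metric.diam Ω ^ 2) * Real.log ((minWeight p.1 - τ) / amin) *
          (2 * Metric.diam Ω ^ 2 / lam ^ 2) := mul_le_mul_of_nonneg_right h1 (by positivity)
      _ = _ := by field_simp
  have hpos : 0 < minWeight p.1 - τ := by linarith
  have h3 : amin / (minWeight p.1 - τ) ≤
      Real.exp (-(2 * (η * Metric.diam Ω ^ 2 / lam ^ 2))) := by
    rw [← Real.exp_log (div_pos hamin hpos), Real.exp_le_exp, ← inv_div, Real.log_inv]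
    linarith
  have h4 := minWeight_le p.1 m
  have h5 : 0 < p.1 m := by linarith
  refine lt_of_lt_of_le ?_ (mul_le_mul_of_nonneg_left h3 h5.le)
  rw [mul_div_assoc', lt_div_iff₀ hpos, mul_comm]
  exact mul_lt_mul_of_pos_right (by linarith) hamin

theorem lt_infDist_of_le_etaRet (hδ : 0 < δ) (hη : 0 < η)
    (h : (η : EReal) ≤ etaRet Ω amin Dmin lam δ τ p) (m : Fin M) :
    η * Metric.diam Ω < Metric.infDist (p.2 m) (frontier Ω) := by
  have hD := diam_pos_of_le_etaRet hη h
  have hc : (0 : EReal) ≤ ((1 / (2 * Metric.diam Ω) : ℝ) : EReal) :=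
    EReal.coe_nonneg.2 (by positivity)
  have h1 := h.trans ((min_le_right _ _).trans (mul_le_mul_of_nonneg_left (min_le_left _ _) hc))
  rw [← EReal.coe_mul, EReal.coe_le_coe_iff, one_div_mul_eq_div, le_div_iff₀ (by positivity)] at h1
  have h2 := boundaryDist_le (Ω := Ω) p.2 m
  have h3 := mul_pos hη hD
  linarith

theorem add_lt_norm_sub_of_le_etaRet (hδ : 0 < δ) (hη : 0 < η)
    (h : (η : EReal) ≤ etaRet Ω amin Dmin lam δ τ p) {m n : Fin M} (hmn : m ≠ n) :
    Dmin + 2 * (η * Metric.diam Ω) < ‖p.2 m - p.2 n‖ := by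
  have hD := diam_pos_of_le_etaRet hη h
  have hc : (0 : EReal) ≤ ((1 / (2 * Metric.diam Ω) : ℝ) : EReal) :=
    EReal.coe_nonneg.2 (by positivity)
  have h1 := h.trans ((min_le_right _ _).trans (mul_le_mul_of_nonneg_left
    ((min_le_right _ _).trans (EReal.sub_le_sub (atomSep_le p.2 hmn) le_rfl)) hc))
  rw [← EReal.coe_sub, ← EReal.coe_mul, EReal.coe_le_coe_iff, one_div_mul_eq_div,
    le_div_iff₀ (by positivity)] at h1
  linarith

end StepSize

end SinkhornSHK

open SinkhornSHK in
theorem theorem3 {d M N : ℕ} (Ω : Set (EuclideanSpace ℝ (Fin d)))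
    (hΩ_open : IsOpen Ω) (hΩ_bdd : Bornology.IsBounded Ω) (hΩ_conv : Convex ℝ Ω)
    (amin Dmin ε β lam : ℝ) (hamin : 0 < amin) (hDmin : 0 < Dmin) (hε : 0 < ε) (hβ : 0 < β)
    (hlam : 0 < lam)
    -- the stored patterns `X j = ∑ m, b_{j,m} δ_{y_{j,m}}`, with `p j = (b_j, y_j)`
    (p : Fin N → SinkhornSHK.Params M d)
    (hp : ∀ j, p j ∈ SinkhornSHK.paramSpace M Ω amin Dmin)
    (X : Fin N → MeasureTheory.Measure (EuclideanSpace ℝ (Fin d)))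
    (hX : ∀ j, X j = SinkhornSHK.toMeasure (p j))
    (i : Fin N) (r Δ : ℝ) (hr : 0 < r) (hΔ : 0 < Δ)
    (hsep : SinkhornSHK.MarginSeparation M Ω amin Dmin ε X i r Δ) :
    -- (1) closeness of a basin minimizer to the stored pattern
    (∀ Xstar, SinkhornSHK.IsBasinMinimizer M Ω amin Dmin ε β X i r Xstar →
      SinkhornSHK.sinkhorn ε Xstar (X i) ≤
          1 / β * Real.log (1 + ((N : ℝ) - 1) * Real.exp (-β * Δ)) ∧
        1 / β * Real.log (1 + ((N : ℝ) - 1) * Real.exp (-β * Δ)) ≤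
          ((N : ℝ) - 1) / β * Real.exp (-β * Δ)) ∧
    -- (2) the gradient at the stored pattern exists and is unique, one step is well-defined
    -- and moves the stored pattern only a little
    (∃! g, SinkhornSHK.IsSHKGradient Ω amin Dmin lam (SinkhornSHK.energy ε β X) (p i) g) ∧
    (∀ δ τ η : ℝ, 0 < δ → (δ : EReal) < SinkhornSHK.deltaBar Ω Dmin (p i) →
      0 < τ → τ < SinkhornSHK.minWeight (p i).1 - amin →
      0 < η → (η : EReal) ≤ SinkhornSHK.etaRet Ω amin Dmin lam δ τ (p i) →
      SinkhornSHK.shkStep Ω amin Dmin lam (SinkhornSHK.energy ε β X) η (p i) ∈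
          SinkhornSHK.paramSpace M Ω amin Dmin ∧
        SinkhornSHK.sinkhorn ε (X i)
            (SinkhornSHK.toMeasure
              (SinkhornSHK.shkStep Ω amin Dmin lam (SinkhornSHK.energy ε β X) η (p i))) ≤
          min (Real.exp (η * Metric.diam Ω ^ 2 / lam ^ 2)) (1 / Real.sqrt amin) * η *
              SinkhornSHK.gradBound (Metric.diam Ω) lam ^ 2 * ((N : ℝ) - 1) *
              Real.exp (-β * Δ) /
            (1 + ((N : ℝ) - 1) * Real.exp (-β * Δ))) := by
  have hN : (1 : ℝ) ≤ N := by exact_mod_cast i.pos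
  have hK : 0 ≤ ((N : ℝ) - 1) * Real.exp (-β * Δ) :=
    mul_nonneg (sub_nonneg.2 hN) (Real.exp_pos _).le
  set W : ℝ := ((N : ℝ) - 1) * Real.exp (-β * Δ) / (1 + ((N : ℝ) - 1) * Real.exp (-β * Δ))
    with hW
  have hW0 : 0 ≤ W := by positivity
  have hW1 : W ≤ 1 := div_le_one_of_le₀ (by linarith) (by linarith)
  have hpi := isProper_of_mem_paramSpace hamin hDmin (hp i)
  obtain ⟨L, h, k, hL, hLw, hh, hk⟩ := exists_hasFDerivWithinAt_energy hΩ_open hΩ_bdd hamin hDmin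
    hε hβ hr.le hp hX hsep hW
  have hgrad : IsSHKGradient Ω amin Dmin lam (energy ε β X) (p i)
      (rieszVector lam (p i) h k) :=
    ⟨rieszVector_mem_tangent lam hpi h k, L, hL, fun w hw => by
      rw [shkInner_rieszVector hlam hpi h k hw, hLw w hw]⟩
  refine ⟨fun ξ hξ => ⟨sinkhorn_le_of_isBasinMinimizer hβ hr.le hp hX hsep hξ, ?_⟩,
    ⟨_, hgrad, fun g hg => isSHKGradient_unique hΩ_open hamin hDmin hlam (hp i) hg hgrad⟩, ?_⟩
  · have h1 := Real.log_le_sub_one_of_pos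
      (show 0 < 1 + ((N : ℝ) - 1) * Real.exp (-β * Δ) by linarith)
    rw [one_div_mul_eq_div, div_mul_eq_mul_div]
    exact div_le_div_of_nonneg_right (by linarith) hβ.le
  · intro δ τ η hδ _ hτ hτ' hη hη'
    have hD := diam_pos_of_le_etaRet hη hη'
    have hgrad_eq : shkGradient Ω amin Dmin lam (energy ε β X) (p i) =
        rieszVector lam (p i) h k :=
      isSHKGradient_unique hΩ_open hamin hDmin hlam (hp i)
        (Classical.epsilon_spec (p := fun g => IsSHKGradient Ω amin Dmin lam (energy ε β X) (p i) g)
          ⟨_, hgrad⟩) hgrad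
    unfold shkStep
    rw [hgrad_eq]
    set v : Params M d := -η • rieszVector lam (p i) h k with hv
    have hv1 : ∀ m, |v.1 m / (p i).1 m| ≤ W * (η * Metric.diam Ω ^ 2 / lam ^ 2) := fun m => by
      have e : v.1 m / (p i).1 m = -(η / lam ^ 2 * (h m - ∑ j, (p i).1 j * h j)) := by
        have := (hpi.pos m).ne'
        simp only [hv, rieszVector, Prod.smul_fst, Pi.smul_apply, smul_eq_mul]
        field_simp
      have hosc : |h m - ∑ j, (p i).1 j * h j| ≤ W * Metric.diam Ω ^ 2 := by
        have := norm_sub_sum_smul_le (V := ℝ) (fun j => (hpi.pos j).le) hpi.sum_eq (c := h m)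
          (e := h) (D := W * Metric.diam Ω ^ 2) fun j => abs_le.2 ⟨by linarith [hh j m], hh m j⟩
        simpa using this
      rw [e, abs_neg, abs_mul, abs_of_pos (by positivity)]
      calc _ ≤ η / lam ^ 2 * (W * Metric.diam Ω ^ 2) :=
            mul_le_mul_of_nonneg_left hosc (by positivity)
        _ = _ := by ring
    have hv2 : ∀ m, ‖v.2 m‖ ≤ W * (η * Metric.diam Ω) := fun m => by
      have e : v.2 m = -η • k m := rfl
      rw [e, norm_smul, norm_neg, Real.norm_of_nonneg hη.le]
      calc _ ≤ η * (W * Metric.diam Ω) := mul_le_mul_of_nonneg_left (hk m) hη.le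
        _ = _ := by ring
    have hmem : ∀ t ∈ Set.Icc (0 : ℝ) 1,
        retraction (p i) (t • v) ∈ paramSpace M Ω amin Dmin := fun t ht => by
      have htW : t * W ≤ 1 := mul_le_one₀ ht.2 hW0 hW1
      refine retraction_mem_paramSpace hΩ_open hamin hDmin (hp i)
        (A := η * Metric.diam Ω ^ 2 / lam ^ 2) (B := η * Metric.diam Ω) (fun m => ?_) (fun m => ?_)
        (lt_mul_exp_of_le_etaRet hamin hlam hτ hτ' hη hη') (lt_infDist_of_le_etaRet hδ hη hη')
        fun m n hmn => add_lt_norm_sub_of_le_etaRet hδ hη hη' hmn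
      · have e : (t • v).1 m / (p i).1 m = t * (v.1 m / (p i).1 m) := by
          simp [mul_div_assoc]
        rw [e, abs_mul, abs_of_nonneg ht.1]
        calc _ ≤ t * (W * (η * Metric.diam Ω ^ 2 / lam ^ 2)) :=
              mul_le_mul_of_nonneg_left (hv1 m) ht.1
          _ = t * W * (η * Metric.diam Ω ^ 2 / lam ^ 2) := by ring
          _ ≤ _ := mul_le_of_le_one_left (by positivity) htW
      · have e : (t • v).2 m = t • v.2 m := rfl
        rw [e, norm_smul, Real.norm_of_nonneg ht.1]
        calc _ ≤ t * (W * (η * Metric.diam Ω)) := mul_le_mul_of_nonneg_left (hv2 m) ht.1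
          _ = t * W * (η * Metric.diam Ω) := by ring
          _ ≤ _ := mul_le_of_le_one_left (by positivity) htW
    refine ⟨by simpa using hmem 1 (Set.right_mem_Icc.2 zero_le_one), ?_⟩
    rw [hX i]
    refine (sinkhorn_retraction_le hΩ_bdd hamin hDmin hε (hp i) hv1 hv2 hmem).trans ?_
    have hG : gradBound (Metric.diam Ω) lam ^ 2 =
        Metric.diam Ω ^ 2 * (1 + Metric.diam Ω ^ 2 / lam ^ 2) := by
      rw [gradBound, mul_pow, Real.sq_sqrt (by positivity)]
    -- The curve is short enough that the bound holds already with the factor `1` for the minimum.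
    have hmin : 1 ≤ min (Real.exp (η * Metric.diam Ω ^ 2 / lam ^ 2)) (1 / Real.sqrt amin) := by
      refine le_min (Real.one_le_exp (by positivity)) ?_
      have hM : Nonempty (Fin M) := by
        by_contra hM
        have := not_nonempty_iff.1 hM
        simpa using hpi.sum_eq
      obtain ⟨m⟩ := hM
      have ha1 : (p i).1 m ≤ 1 := hpi.sum_eq ▸
        Finset.single_le_sum (fun j _ => (hpi.pos j).le) (Finset.mem_univ m)
      rw [one_div]
      refine (one_le_inv₀ (Real.sqrt_pos.2 hamin)).2 (Real.sqrt_le_one.2 ?_)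
      exact (((hp i).1 m).trans_le ha1).le
    have e1 : Metric.diam Ω ^ 2 * (W * (η * Metric.diam Ω ^ 2 / lam ^ 2)) +
        Metric.diam Ω * (W * (η * Metric.diam Ω)) =
        1 * (η * (Metric.diam Ω ^ 2 * (1 + Metric.diam Ω ^ 2 / lam ^ 2)) * W) := by ring
    rw [e1, hG]
    refine (mul_le_mul_of_nonneg_right hmin (by positivity)).trans_eq ?_
    rw [hW]
    ring
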